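/- Let $m\ge 0$, let $d_0,\dots,d_m\ge 1$ be integers, $n=d_0+\cdots+d_m$ and $\mathbb C^n=\mathbb C^{d_0}\oplus\cdots\oplus\mathbb C^{d_m}$. Let $Y$ be a complex $n\times n$ block matrix all of whose blocks vanish except possibly the blocks $Y_j:\mathbb C^{d_{j-1}}\to\mathbb C^{d_j}$ ($1\le j\le m$) directly below the diagonal. Let $\tilde G$ be the universal covering group of the Möbius group of the unit disc $\mathbb D$, and for $\eta\in\mathbb R$ let $E^{(\eta,Y)}$ be the $\tilde G$-homogeneous holomorphic vector bundle over $\mathbb D$ whose sections are the holomorphic functions $\mathbb D\to\mathbb C^n$, with the action $f\mapsto J_{g^{-1}}\cdot(f\circ g^{-1})$ of $\tilde G$ given by the multiplier $$\big(J_g(z)\big)_{p,\ell}=\begin{cases}\frac{1}{(p-\ell)!}(-c_g)^{p-\ell}\,(g')(z)^{\eta+\frac{p+\ell}{2}}\;Y_p\cdots Y_{\ell+1}, & p\ge \ell,\\ 0, & p<\ell,\end{cases}$$ where $g$ acts by $z\mapsto (az+b)/(cz+d)$ with $\begin{pmatrix}a&b\\c&d\end{pmatrix}\in SU(1,1)$,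 $c_g=c$, and the powers of $g'(z)=(cz+d)^{-2}$ are the analytic branches on $\tilde G\times\mathbb D$. The bundle carries the invariant Hermitian structure which is the standard inner product $I$ on the fibre $\mathbb C^n$ over $0$. Let $\mathcal P$ be the set of pairs $(\eta,Y)$ such that $(E^{(\eta,Y)},I)$ has a reproducing kernel, that is, such that there is a Hilbert space of holomorphic functions $\mathbb D\to\mathbb C^n$ with continuous point evaluations, containing all $\mathbb C^n$-valued polynomials, on which $\tilde G$ acts unitarily, i.e. whose reproducing kernel $K$ satisfies $$K(z,w)=J_g(z)\,K(gz,gw)\,J_g(w)^*\qquad(g\in\tilde G,\ z,w\in\mathbb D),$$ and which induces the given Hermitian structure, i.e. $K(0,0)=I$. Then for every such $Y$ there is a real number $\eta_Y\ge 0$ such that, for all $\eta\in\mathbb R$, $$(\eta,Y)\in\mathcal P\iff \eta>\eta_Y ,$$ and $\eta_Y>0$ whenever $m\ge1$ and $Y_1\neq 0$. -/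

import Mathlib

open scoped ComplexConjugate Complex.UnitDisc

noncomputable section

namespace HomogeneousBundle

/-- The universal covering group `G̃` of the Moebius group of the unit disc, in its standard explicit
model: an element is a matrix `(a, b; conj b, conj a)` of `SU(1,1)` (so `c = conj b`,
`d = conj a`, `|a|² - |b|² = 1`) together with a continuous branch on the disc of
`z ↦ log (c z + d)`. -/
@[ext]
structure CoverG where
  a : ℂ
  b : ℂ
  det_eq : Complex.normSq a - Complex.normSq b = 1
  logDenom : 𝔻 → ℂ
  continuous_logDenom : Continuous logDenom
  exp_logDenom : ∀ z : 𝔻, Complex.exp (logDenom z) = conj b * (z : ℂ) + conj a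

namespace CoverG

theorem normSq_num_lt_normSq_denom (g : CoverG) (z : 𝔻) :
    Complex.normSq (g.a * z + g.b) < Complex.normSq (conj g.b * z + conj g.a) := by
  have h := g.det_eq
  have hz := Complex.UnitDisc.normSq_lt_one z
  have key : Complex.normSq (conj g.b * z + conj g.a) - Complex.normSq (g.a * z + g.b)
      = (Complex.normSq g.a - Complex.normSq g.b) * (1 - Complex.normSq (z : ℂ)) := by
    simp only [Complex.normSq_apply, Complex.add_re, Complex.add_im, Complex.mul_re,
      Complex.mul_im, Complex.conj_re, Complex.conj_im]
    ring
  rw [h] at key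
  linarith

theorem norm_moebius_lt_one (g : CoverG) (z : 𝔻) :
    ‖(g.a * z + g.b) / (conj g.b * z + conj g.a)‖ < 1 := by
  have h := g.normSq_num_lt_normSq_denom z
  rw [← Complex.sq_norm, ← Complex.sq_norm] at h
  have h2 := lt_of_pow_lt_pow_left₀ 2 (norm_nonneg _) h
  rw [norm_div, div_lt_one (lt_of_le_of_lt (norm_nonneg _) h2)]
  exact h2

/-- The action `z ↦ (a z + b) / (c z + d)` of `G̃` on the disc. -/
def act (g : CoverG) (z : 𝔻) : 𝔻 :=
  Complex.UnitDisc.mk ((g.a * z + g.b) / (conj g.b * z + conj g.a)) (g.norm_moebius_lt_one z)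

/-- The power `(g')(z) ^ s` of the derivative `g'(z) = (c z + d)⁻²`, analytic on `G̃ × 𝔻`. -/
def derivPow (g : CoverG) (s : ℝ) (z : 𝔻) : ℂ :=
  Complex.exp (-2 * (s : ℂ) * g.logDenom z)

/-- The function `c_g` on `G̃`. -/
def c (g : CoverG) : ℂ := conj g.b

end CoverG

/-- Index set of the standard basis of `ℂⁿ = ℂ^{d 0} ⊕ ⋯ ⊕ ℂ^{d m}`. -/
abbrev BlockIndex {m : ℕ} (d : Fin (m + 1) → ℕ) : Type := Σ j : Fin (m + 1), Fin (d j)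

/-- The space `ℂⁿ = ℂ^{d 0} ⊕ ⋯ ⊕ ℂ^{d m}` with its standard inner product. -/
abbrev Fiber {m : ℕ} (d : Fin (m + 1) → ℕ) : Type := EuclideanSpace ℂ (BlockIndex d)

/-- `Y` is a block matrix whose only possibly nonzero blocks are
`Y_j : ℂ^{d (j-1)} → ℂ^{d j}`, `j = 1, …, m`, just below the diagonal. -/
def IsBlockSubdiagonal {m : ℕ} {d : Fin (m + 1) → ℕ}
    (Y : Matrix (BlockIndex d) (BlockIndex d) ℂ) : Prop :=
  ∀ p q : BlockIndex d, (p.1 : ℕ) ≠ (q.1 : ℕ) + 1 → Y p q = 0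

/-- The block `Y_1 : ℂ^{d 0} → ℂ^{d 1}` of `Y` is not zero (in particular `m ≥ 1`). -/
def FirstBlockNonzero {m : ℕ} {d : Fin (m + 1) → ℕ}
    (Y : Matrix (BlockIndex d) (BlockIndex d) ℂ) : Prop :=
  ∃ p q : BlockIndex d, (p.1 : ℕ) = 1 ∧ (q.1 : ℕ) = 0 ∧ Y p q ≠ 0

/-- The multiplier `J_g^{(η,Y)}(z)` of `E^{(η,Y)}`. For block subdiagonal `Y` and `ℓ ≤ p` the
product `Y_p ⋯ Y_{ℓ+1}` is the `(p, ℓ)` block of `Y ^ (p - ℓ)`. -/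
def multiplier {m : ℕ} {d : Fin (m + 1) → ℕ} (η : ℝ)
    (Y : Matrix (BlockIndex d) (BlockIndex d) ℂ) (g : CoverG) (z : 𝔻) :
    Matrix (BlockIndex d) (BlockIndex d) ℂ :=
  Matrix.of fun p q =>
    if (q.1 : ℕ) ≤ (p.1 : ℕ) then
      (1 / (Nat.factorial ((p.1 : ℕ) - (q.1 : ℕ)) : ℂ)) * (-g.c) ^ ((p.1 : ℕ) - (q.1 : ℕ)) *
        g.derivPow (η + (((p.1 : ℕ) : ℝ) + ((q.1 : ℕ) : ℝ)) / 2) z *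
        (Y ^ ((p.1 : ℕ) - (q.1 : ℕ))) p q
    else 0

/-- The multiplier as an operator on the fibre. -/
def multiplierCLM {m : ℕ} {d : Fin (m + 1) → ℕ} (η : ℝ)
    (Y : Matrix (BlockIndex d) (BlockIndex d) ℂ) (g : CoverG) (z : 𝔻) :
    Fiber d →L[ℂ] Fiber d :=
  Matrix.toEuclideanCLM (𝕜 := ℂ) (multiplier η Y g z)

/-- Holomorphic functions on the disc, that is, holomorphic sections in the trivialization. -/
def IsHolomorphic {V : Type*} [NormedAddCommGroup V] [NormedSpace ℂ V] (f : 𝔻 → V) : Prop :=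
  ∃ F : ℂ → V, DifferentiableOn ℂ F (Metric.ball 0 1) ∧ ∀ z : 𝔻, f z = F z

/-- The reproducing kernel Hilbert space `H` of functions `𝔻 → ℂⁿ` makes the homogeneous
holomorphic Hermitian vector bundle `(E^{(η,Y)}, I)` a bundle with a reproducing kernel. -/
structure IsReproducingSpace {m : ℕ} {d : Fin (m + 1) → ℕ} (η : ℝ)
    (Y : Matrix (BlockIndex d) (BlockIndex d) ℂ)
    (H : Type) [NormedAddCommGroup H] [InnerProductSpace ℂ H] [CompleteSpace H]
    [RKHS ℂ H 𝔻 (Fiber d)] : Prop where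
  /-- `H` consists of holomorphic sections. -/
  holomorphic : ∀ f : H, IsHolomorphic (fun z : 𝔻 => f z)
  /-- `H` contains all polynomial sections (the `K̃`-finite holomorphic sections). -/
  polynomial_mem : ∀ (k : ℕ) (v : Fiber d), ∃ f : H, ∀ z : 𝔻, f z = (z : ℂ) ^ k • v
  /-- `G̃` acts unitarily on `H`: `K(z,w) = J_g(z) K(g z, g w) J_g(w)^*`. -/
  kernel_invariant : ∀ (g : CoverG) (z w : 𝔻),
    RKHS.kernel H z w = (multiplierCLM η Y g z).comp
      ((RKHS.kernel H (g.act z) (g.act w)).comp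
        (ContinuousLinearMap.adjoint (multiplierCLM η Y g w)))
  /-- The induced invariant Hermitian structure `K(z,z)⁻¹` is the one which is `I` at `0`. -/
  kernel_zero : RKHS.kernel H 0 0 = ContinuousLinearMap.id ℂ (Fiber d)

/-- `(E^{(η,Y)}, I)` has a reproducing kernel. -/
def HasReproducingKernel {m : ℕ} {d : Fin (m + 1) → ℕ} (η : ℝ)
    (Y : Matrix (BlockIndex d) (BlockIndex d) ℂ) : Prop :=
  ∃ (H : Type) (_ : NormedAddCommGroup H) (_ : InnerProductSpace ℂ H) (_ : CompleteSpace H)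
    (_ : RKHS ℂ H 𝔻 (Fiber d)), IsReproducingSpace η Y H

/-- The set `𝒫` of all `(η, Y)` (`η` real, `Y` of block type `d`) such that `(E^{(η,Y)}, I)` has
a reproducing kernel. -/
def reproducingPairs {m : ℕ} (d : Fin (m + 1) → ℕ) :
    Set (ℝ × Matrix (BlockIndex d) (BlockIndex d) ℂ) :=
  {x | IsBlockSubdiagonal x.2 ∧ HasReproducingKernel x.1 x.2}

end HomogeneousBundle

end

noncomputable section

namespace HomogeneousBundle

open Matrix Filter Topology
open scoped ComplexOrder

/-! Put λ = 2η. An invariant kernel normalised to be the identity at the origin is unique: it is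
`kernelMatrix`, the product of (1 - z w̄)^{-λ} with D exp(w̄ Y) exp(z Y^*) D
(`kernelMatrix_invariant`, `kernel_eq_kernelMatrix`). So the question is whether this one explicit
kernel is positive and its Hilbert space contains all polynomials.

Expanding in powers gives one Hermitian matrix `gramMatrix` for each degree N. Up to the entries
that vanish for degree reasons, these are the Gram matrices of the homogeneous sections representing
Taylor coefficients. The bundle has a reproducing kernel exactly when all of them are positive
definite on the components of index at most N. Degree 1 already forces λ > 0.

For λ > 0 the kernel decomposes into images of weighted Bergman kernels with parameters λ + 2i,
weighted by the matrices `levelGram`. On Gram matrices this is the factorization `gramMatrix_eq`,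
whose combinatorial core is the Pfaff–Saalschütz sum (`sum_binom_mul`). The outer factors are
triangular and invertible, so the infinitely many conditions collapse to the single condition
`IsAdmissible`: λ > 0 and the block diagonal matrix `fullGram` is positive definite.

The admissible λ form an open set by continuity, and a nonempty one because `fullGram` tends to the
identity as λ → ∞. They are closed under increase because multiplying the kernel by (1 - z w̄)^{-ε}
adds nonnegative terms to the Gram matrices (`gramMatrix_add`). Hence they form an open half-line
bounded below by 0. The level-one block I - λ⁻¹ Y_1 Y_1^* keeps the endpoint away from 0 when Y_1 ≠
0. -/

/-- The rising factorial `x (x + 1) ⋯ (x + n - 1)`. -/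
def rising {R : Type*} [CommRing R] (x : R) (n : ℕ) : R := ∏ i ∈ Finset.range n, (x + i)

/-! ### Rising factorials and the Saalschütz sum. -/

section Rising

variable {R : Type*} [CommRing R]

@[simp] theorem rising_zero (x : R) : rising x 0 = 1 := by simp [rising]

theorem rising_succ (x : R) (n : ℕ) : rising x (n + 1) = rising x n * (x + n) := by
  simp [rising, Finset.prod_range_succ]

theorem rising_add (x : R) (n k : ℕ) : rising x (n + k) = rising x n * rising (x + n) k := by
  simp [rising, Finset.prod_range_add, add_assoc]

theorem rising_pos {x : ℝ} (hx : 0 < x) (n : ℕ) : 0 < rising x n :=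
  Finset.prod_pos fun i _ => by positivity

/-- At negative integers the product hits zero; this is what makes the hypergeometric sums
terminate. -/
theorem rising_neg_natCast (q k : ℕ) :
    rising (-(q : R)) k = (-1) ^ k * (q.descFactorial k : R) := by
  induction k with
  | zero => simp
  | succ k ih =>
    rw [rising_succ, ih, Nat.descFactorial_succ]
    rcases le_or_gt k q with h | h
    · rw [Nat.cast_mul, Nat.cast_sub h]; ring
    · rw [Nat.descFactorial_of_lt h]; simp

/-- The Chu–Vandermonde identity for rising factorials. -/
theorem rising_add_eq_sum (x y : R) (n : ℕ) :
    rising (x + y) n =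
      ∑ k ∈ Finset.range (n + 1), (n.choose k : R) * rising x k * rising y (n - k) := by
  induction n with
  | zero => simp
  | succ n ih =>
    rw [rising_succ, ih, Finset.sum_range_succ' _ (n + 1), Finset.sum_mul]
    have h1 : ∀ k ∈ Finset.range (n + 1),
        ((n + 1).choose (k + 1) : R) * rising x (k + 1) * rising y (n + 1 - (k + 1)) =
        (n.choose k : R) * rising x k * rising y (n - k) * (x + k) +
        (n.choose (k + 1) : R) * rising x (k + 1) * rising y (n - k) := by
      intro k _
      rw [Nat.choose_succ_succ, rising_succ, Nat.add_sub_add_right]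
      push_cast; ring
    rw [Finset.sum_congr rfl h1, Finset.sum_add_distrib]
    have h2 : ∑ k ∈ Finset.range (n + 1),
          (n.choose (k + 1) : R) * rising x (k + 1) * rising y (n - k) +
          ((n + 1).choose 0 : R) * rising x 0 * rising y (n + 1 - 0) =
        ∑ k ∈ Finset.range (n + 1), (n.choose k : R) * rising x k * rising y (n + 1 - k) := by
      rw [Finset.sum_range_succ' (fun k => (n.choose k : R) * rising x k * rising y (n + 1 - k)),
        Finset.sum_range_succ]
      simp
    rw [add_assoc (∑ _ ∈ _, _), h2, ← Finset.sum_add_distrib]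
    refine Finset.sum_congr rfl fun k hk => ?_
    have hk' : k ≤ n := Nat.lt_succ_iff.mp (Finset.mem_range.mp hk)
    rw [Nat.succ_sub hk', rising_succ, Nat.cast_sub hk']
    ring

/-- The Pfaff–Saalschütz identity, in denominator-free form. -/
theorem saalschutz (a b d : R) (n : ℕ) :
    ∑ k ∈ Finset.range (n + 1), (n.choose k : R) * rising a k * rising d (n - k) *
        (rising b k * rising (b + k + (a + d)) (n - k)) =
      rising (a + d) n * rising (b + d) n := by
  -- Expand the last factor by Chu–Vandermonde with s = k + j, exchange the sums, resum over k by
  -- Chu–Vandermonde, and use it a third time for the sum over s.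
  have h1 : ∀ k ∈ Finset.range (n + 1), (n.choose k : R) * rising a k * rising d (n - k) *
        (rising b k * rising (b + k + (a + d)) (n - k)) =
      ∑ s ∈ Finset.Ico k (n + 1), (n.choose k : R) * ((n - k).choose (s - k) : R) *
        rising a k * rising d (n - k) * rising b s * rising (a + d) (n - s) := by
    intro k hk
    have hk' : k ≤ n := Nat.lt_succ_iff.mp (Finset.mem_range.mp hk)
    rw [rising_add_eq_sum, Finset.sum_Ico_eq_sum_range, Nat.succ_sub hk', Finset.mul_sum,
      Finset.mul_sum]
    refine Finset.sum_congr rfl fun j _ => ?_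
    rw [rising_add b k j, Nat.add_sub_cancel_left, Nat.sub_sub]
    ring
  rw [Finset.sum_congr rfl h1, Finset.sum_sigma',
    Finset.sum_bij' (t := (Finset.range (n + 1)).sigma fun s => Finset.range (s + 1))
      (g := fun x => (n.choose x.2 : R) * ((n - x.2).choose (x.1 - x.2) : R) *
        rising a x.2 * rising d (n - x.2) * rising b x.1 * rising (a + d) (n - x.1))
      (fun x _ => ⟨x.2, x.1⟩) (fun x _ => ⟨x.2, x.1⟩) (by simp; omega) (by simp; omega)
      (by simp) (by simp) (by simp), Finset.sum_sigma]
  have h2 : ∀ s ∈ Finset.range (n + 1), ∑ k ∈ Finset.range (s + 1),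
        (n.choose k : R) * ((n - k).choose (s - k) : R) *
        rising a k * rising d (n - k) * rising b s * rising (a + d) (n - s) =
      rising (a + d) n * ((n.choose s : R) * rising b s * rising d (n - s)) := by
    intro s hs
    have hs' : s ≤ n := Nat.lt_succ_iff.mp (Finset.mem_range.mp hs)
    have h3 : rising (a + d) n = rising (a + d) (n - s) *
        ∑ k ∈ Finset.range (s + 1), (s.choose k : R) * rising a k *
          rising (d + (n - s : ℕ)) (s - k) := by
      rw [← rising_add_eq_sum, ← add_assoc, ← rising_add, Nat.sub_add_cancel hs']
    rw [h3, mul_assoc, Finset.sum_mul, Finset.mul_sum]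
    refine Finset.sum_congr rfl fun k hk => ?_
    have hk' : k ≤ s := Nat.lt_succ_iff.mp (Finset.mem_range.mp hk)
    have h4 : rising d (n - k) = rising d (n - s) * rising (d + (n - s : ℕ)) (s - k) := by
      rw [← rising_add]; congr 1; omega
    have h5 : (n.choose k : R) * ((n - k).choose (s - k) : R) =
        (n.choose s : R) * (s.choose k : R) := by
      rw [← Nat.cast_mul, ← Nat.cast_mul, Nat.choose_mul hk']
    rw [h5, h4]; ring
  rw [Finset.sum_congr rfl h2, ← Finset.mul_sum, ← rising_add_eq_sum]

end Rising

/-! ### The binomial series and its convolution with the intertwining constants. -/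

/-- The coefficient of `x ^ n` in `(1 - x) ^ (-s)`. -/
def binom (s : ℝ) (n : ℕ) : ℝ := rising s n / n.factorial

@[simp] theorem binom_zero (s : ℝ) : binom s 0 = 1 := by simp [binom]

theorem binom_nonneg {s : ℝ} (hs : 0 < s) (n : ℕ) : 0 ≤ binom s n :=
  div_nonneg (rising_pos hs n).le (by positivity)

theorem binom_add (s t : ℝ) (n : ℕ) :
    binom (s + t) n = ∑ k ∈ Finset.range (n + 1), binom s k * binom t (n - k) := by
  rw [binom, rising_add_eq_sum, Finset.sum_div]
  refine Finset.sum_congr rfl fun k hk => ?_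
  have hk' : k ≤ n := Nat.lt_succ_iff.mp (Finset.mem_range.mp hk)
  rw [Nat.cast_choose ℝ hk', binom, binom]
  field_simp

theorem hasSum_binom (s : ℝ) {x : ℂ} (hx : ‖x‖ < 1) :
    HasSum (fun n : ℕ => (binom s n : ℂ) * x ^ n) (Complex.exp (-s * Complex.log (1 - x))) := by
  have h := (Complex.one_div_one_sub_cpow_hasFPowerSeriesOnBall_zero (s : ℂ)).hasSum
    (y := x) (by simpa [Metric.mem_eball, edist_zero_right, ← ofReal_norm] using hx)
  have hx1 : (1 : ℂ) - x ≠ 0 := by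
    intro h0
    rw [← sub_eq_zero.mp h0] at hx
    simp at hx
  have h1 : (1 : ℂ) / (1 - (0 + x)) ^ (s : ℂ) = Complex.exp (-s * Complex.log (1 - x)) := by
    rw [zero_add, Complex.cpow_def_of_ne_zero hx1, one_div, ← Complex.exp_neg]
    congr 1; ring
  rw [h1] at h
  refine h.congr_fun ?_
  intro n
  rw [FormalMultilinearSeries.ofScalars_apply_eq, smul_eq_mul]
  congr 1
  have h2 : (n.factorial : ℂ) * Ring.choose ((s : ℂ) + n - 1) n = rising (s : ℂ) n := by
    have h3 := Ring.descPochhammer_eq_factorial_smul_choose ((s : ℂ) + n - 1) n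
    rw [nsmul_eq_mul] at h3
    rw [← h3, Polynomial.descPochhammer_smeval_eq_ascPochhammer]
    have : (s : ℂ) + n - 1 - n + 1 = s := by ring
    rw [this, Polynomial.ascPochhammer_smeval_eq_eval]
    clear h h1 h3 this
    induction n with
    | zero => simp
    | succ n ih => rw [ascPochhammer_succ_eval, ih, rising_succ]
  have h3 : ((rising s n : ℝ) : ℂ) = rising (s : ℂ) n := by simp [rising]
  rw [binom, Complex.ofReal_div, h3, ← h2, Complex.ofReal_natCast]
  exact mul_div_cancel_left₀ _ (Nat.cast_ne_zero.mpr n.factorial_ne_zero)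

/-- Apart from the factor depending on N alone, the right side separates into a factor in p and a
factor in q. This separation is the combinatorial content of `gramMatrix_eq`. -/
theorem sum_binom_mul {lam : ℝ} (hl : 0 < lam) {p q N : ℕ} (hp : p ≤ N) (hq : q ≤ N) :
    ∑ r ∈ Finset.range (min p q + 1),
      (if p + q ≤ N + r then binom (lam + p + q) (N + r - p - q) /
          ((p - r).factorial * (q - r).factorial) else 0) *
        (1 / (r.factorial * rising lam r)) =
    1 / (p.factorial * rising lam p) * (1 / (q.factorial * rising lam q)) *
      (N.factorial * rising lam N) / ((N - p).factorial * (N - q).factorial) := by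
  -- With these parameters a + d = -N and b + d = λ + q, so three of the factors become descending
  -- factorials up to sign.
  have hs := saalschutz (-(q : ℝ)) (lam + N) (-(((N - q : ℕ) : ℝ))) p
  have e1 : -(q : ℝ) + -((N - q : ℕ) : ℝ) = -(N : ℝ) := by rw [Nat.cast_sub hq]; ring
  have e2 : lam + N + -((N - q : ℕ) : ℝ) = lam + q := by rw [Nat.cast_sub hq]; ring
  rw [e1, e2, rising_neg_natCast] at hs
  have hpos : ∀ n, rising lam n ≠ 0 := fun n => (rising_pos hl n).ne'
  have hfac : ∀ n : ℕ, (n.factorial : ℝ) ≠ 0 := fun n => by positivity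
  have hsum : ∑ k ∈ Finset.range (p + 1), (p.choose k : ℝ) * q.descFactorial k *
      (N - q).descFactorial (p - k) * (rising (lam + N) k * rising (lam + k) (p - k)) =
      N.descFactorial p * rising (lam + q) p := by
    have h1 : ((-1 : ℝ) ^ p) ≠ 0 := by simp
    apply mul_left_cancel₀ h1
    rw [← mul_assoc, ← hs, Finset.mul_sum]
    refine Finset.sum_congr rfl fun k hk => ?_
    have hk' : k ≤ p := Nat.lt_succ_iff.mp (Finset.mem_range.mp hk)
    have e3 : lam + N + k + -(N : ℝ) = lam + k := by ring
    have e4 : ((-1 : ℝ) ^ p) = (-1) ^ k * (-1) ^ (p - k) := by rw [← pow_add]; congr 1; omega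
    rw [rising_neg_natCast, rising_neg_natCast, e3, e4]
    ring
  -- W collects everything in the r-th term that does not depend on r.
  set W : ℝ := rising lam N / (rising lam (p + q) * rising lam p * p.factorial * q.factorial *
    (N - q).factorial) with hW
  have hterm : ∀ r ∈ Finset.range (min p q + 1),
      (if p + q ≤ N + r then binom (lam + p + q) (N + r - p - q) /
          ((p - r).factorial * (q - r).factorial) else 0) *
        (1 / (r.factorial * rising lam r)) =
      ((p.choose r : ℝ) * q.descFactorial r *
      (N - q).descFactorial (p - r) * (rising (lam + N) r * rising (lam + r) (p - r))) * W := by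
    intro r hr
    have hr' : r ≤ p ∧ r ≤ q := by
      have := Nat.lt_succ_iff.mp (Finset.mem_range.mp hr)
      exact le_min_iff.mp this
    split_ifs with h
    · have d1 : ((q - r).factorial : ℝ) * q.descFactorial r = q.factorial := by
        exact_mod_cast Nat.factorial_mul_descFactorial hr'.2
      have d2 : ((N + r - p - q).factorial : ℝ) * (N - q).descFactorial (p - r) =
          (N - q).factorial := by
        have := Nat.factorial_mul_descFactorial (n := N - q) (k := p - r) (by omega)
        rw [show N - q - (p - r) = N + r - p - q by omega] at this
        exact_mod_cast this
      have d3 : rising lam r * rising (lam + r) (p - r) = rising lam p := by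
        rw [← rising_add]; congr 1; omega
      have d4 : rising lam N * rising (lam + N) r =
          rising lam (p + q) * rising (lam + p + q) (N + r - p - q) := by
        have : lam + p + q = lam + ((p + q : ℕ) : ℝ) := by push_cast; ring
        rw [← rising_add, this, ← rising_add]; congr 1; omega
      rw [Nat.cast_choose ℝ hr'.1, binom, hW, ← d1, ← d2, ← d3]
      have k1 : rising (lam + r) (p - r) ≠ 0 := (rising_pos (by positivity) _).ne'
      have k2 : (q.descFactorial r : ℝ) ≠ 0 := by
        intro h0; rw [h0, mul_zero] at d1; exact hfac q d1.symm
      have k3 : ((N - q).descFactorial (p - r) : ℝ) ≠ 0 := by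
        intro h0; rw [h0, mul_zero] at d2; exact hfac _ d2.symm
      have := hpos r
      have := hpos (p + q)
      field_simp
      linear_combination -d4
    · rw [Nat.descFactorial_of_lt (n := N - q) (k := p - r) (by omega)]
      simp
  rw [Finset.sum_congr rfl hterm, ← Finset.sum_mul]
  have hext : ∑ k ∈ Finset.range (min p q + 1), (p.choose k : ℝ) * q.descFactorial k *
      (N - q).descFactorial (p - k) * (rising (lam + N) k * rising (lam + k) (p - k)) =
      ∑ k ∈ Finset.range (p + 1), (p.choose k : ℝ) * q.descFactorial k *
      (N - q).descFactorial (p - k) * (rising (lam + N) k * rising (lam + k) (p - k)) := by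
    apply Finset.sum_subset
    · intro k; simp; omega
    · intro k hk1 hk2
      rw [Nat.descFactorial_of_lt (n := q) (k := k) (by simp at hk1 hk2; omega)]
      simp
  rw [hext, hsum, hW]
  have d5 : ((N - p).factorial : ℝ) * N.descFactorial p = N.factorial := by
    exact_mod_cast Nat.factorial_mul_descFactorial hp
  have d6 : rising lam (p + q) = rising lam q * rising (lam + q) p := by
    rw [← rising_add, add_comm]
  rw [d6, ← d5]
  have k1 : rising (lam + q) p ≠ 0 := (rising_pos (by positivity) _).ne'
  have := hpos p
  have := hpos q
  field_simp

/-! ### Block algebra of Y, the explicit kernel and its power series. -/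

section BlockAlgebra

variable {m : ℕ} {d : Fin (m + 1) → ℕ}

/-- Matrices acting on `ℂⁿ = ℂ^{d 0} ⊕ ⋯ ⊕ ℂ^{d m}`. -/
abbrev BlockMatrix {m : ℕ} (d : Fin (m + 1) → ℕ) : Type := Matrix (BlockIndex d) (BlockIndex d) ℂ

/-- The index of the summand `ℂ^{d j}` that a basis vector belongs to. -/
def BlockIndex.deg (p : BlockIndex d) : ℕ := (p.1 : ℕ)

theorem BlockIndex.deg_le (p : BlockIndex d) : p.deg ≤ m := Nat.lt_succ_iff.mp p.1.2

variable {Y : BlockMatrix d}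

theorem IsBlockSubdiagonal.pow_apply_eq_zero (hY : IsBlockSubdiagonal Y) {k : ℕ}
    {p q : BlockIndex d} (h : p.deg ≠ q.deg + k) : (Y ^ k) p q = 0 := by
  induction k generalizing q with
  | zero =>
    rw [pow_zero, one_apply_ne]
    rintro rfl
    exact h rfl
  | succ k ih =>
    rw [pow_succ, mul_apply]
    refine Finset.sum_eq_zero fun s _ => ?_
    by_cases hs : s.deg = q.deg + 1
    · rw [ih (by omega), zero_mul]
    · rw [hY s q hs, mul_zero]

theorem IsBlockSubdiagonal.pow_eq_zero (hY : IsBlockSubdiagonal Y) : Y ^ (m + 1) = 0 := by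
  ext p q
  have := p.deg_le
  exact hY.pow_apply_eq_zero (by omega)

variable (Y) in
/-- The block lower triangular matrix whose `(p, s)` block is `c s (p - s) Y_p ⋯ Y_{s+1}`. -/
def lowerSeries (c : ℕ → ℕ → ℂ) : BlockMatrix d :=
  of fun p s => if s.deg ≤ p.deg then c s.deg (p.deg - s.deg) * (Y ^ (p.deg - s.deg)) p s else 0

theorem lowerSeries_apply (c : ℕ → ℕ → ℂ) (p s : BlockIndex d) :
    lowerSeries Y c p s =
      if s.deg ≤ p.deg then c s.deg (p.deg - s.deg) * (Y ^ (p.deg - s.deg)) p s else 0 := rfl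

theorem lowerSeries_apply_of_lt (c : ℕ → ℕ → ℂ) {p s : BlockIndex d} (h : p.deg < s.deg) :
    lowerSeries Y c p s = 0 := by
  rw [lowerSeries_apply, if_neg (by omega)]

theorem lowerSeries_apply_of_eq {c : ℕ → ℕ → ℂ} (hc : ∀ i, c i 0 = 1) {p s : BlockIndex d}
    (h : p.deg = s.deg) : lowerSeries Y c p s = (1 : BlockMatrix d) p s := by
  rw [lowerSeries_apply, if_pos h.ge, h, Nat.sub_self, hc, pow_zero, one_mul]

/-- The middle factor is block diagonal, so only pairs s, t of equal degree contribute; sorting them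
by that degree i gives the sum. Both the kernel and the factorized Gram matrix are read off in this
form. -/
theorem lowerSeries_mul_mul_conjTranspose (c e : ℕ → ℕ → ℂ)
    (X : BlockMatrix d)
    (Xl : ℕ → BlockMatrix d)
    (hX : ∀ s t, X s t = Xl s.deg s t)
    (hl : ∀ i s t, ¬ (s.deg = i ∧ t.deg = i) → Xl i s t = 0) (p q : BlockIndex d) :
    (lowerSeries Y c * X * (lowerSeries Y e)ᴴ) p q =
      ∑ i ∈ Finset.range (min p.deg q.deg + 1), c i (p.deg - i) * conj (e i (q.deg - i)) *
        (Y ^ (p.deg - i) * Xl i * (Y ^ (q.deg - i))ᴴ : BlockMatrix d) p q := by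
  have h1 : ∀ A B C : BlockMatrix d,
      (A * B * Cᴴ) p q = ∑ t, ∑ s, A p s * B s t * conj (C q t) := by
    intro A B C
    simp [mul_apply, Finset.sum_mul]
  simp_rw [h1, Finset.mul_sum (R := ℂ)]
  rw [Finset.sum_comm (s := Finset.range _)]
  refine Finset.sum_congr rfl fun t _ => ?_
  rw [Finset.sum_comm (s := Finset.range _)]
  refine Finset.sum_congr rfl fun s _ => ?_
  rw [lowerSeries_apply, lowerSeries_apply, hX]
  by_cases hst : s.deg = t.deg
  · by_cases hm : s.deg ≤ min p.deg q.deg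
    · rw [if_pos (by omega), if_pos (by omega), Finset.sum_eq_single s.deg]
      · rw [← hst, map_mul]; ring
      · intro i _ hi
        rw [hl i s t (by omega)]; ring
      · intro h
        exact absurd (Finset.mem_range.mpr (by omega)) h
    · rw [Finset.sum_eq_zero]
      · by_cases hp : s.deg ≤ p.deg
        · rw [if_neg (show ¬ t.deg ≤ q.deg by omega)]; simp
        · rw [if_neg hp]; simp
      · intro i hi
        rw [hl i s t (by simp at hi; omega)]; ring
  · rw [hl s.deg s t (by omega), Finset.sum_eq_zero]
    · simp
    · intro i hi
      rw [hl i s t (by omega)]; ring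

/-- The projection onto the summand `ℂ^{d n}`. -/
def levelProj (n : ℕ) : BlockMatrix d :=
  diagonal fun p => if p.deg = n then 1 else 0

theorem levelProj_apply_eq_zero {n : ℕ} {s t : BlockIndex d} (h : ¬ (s.deg = n ∧ t.deg = n)) :
    levelProj n s t = 0 := by
  rw [levelProj, diagonal_apply]
  split_ifs with h1 h2
  · subst h1; exact absurd ⟨h2, h2⟩ h
  · rfl
  · rfl

theorem levelProj_conjTranspose (n : ℕ) : (levelProj n : BlockMatrix d)ᴴ = levelProj n := by
  rw [levelProj, diagonal_conjTranspose]
  congr 1; funext p; simp [apply_ite]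

theorem one_apply_eq_levelProj (s t : BlockIndex d) :
    (1 : BlockMatrix d) s t = levelProj s.deg s t := by
  simp [levelProj, diagonal_apply, one_apply]

variable (Y) in
/-- The exponential of `a Y`. -/
def expY (a : ℂ) : BlockMatrix d :=
  lowerSeries Y fun _ k => a ^ k / k.factorial

/-- Y^k raises the degree by exactly k, so each entry sees at most one term of the exponential
series. -/
theorem expY_eq_exp (hY : IsBlockSubdiagonal Y) (a : ℂ) : expY Y a = IsNilpotent.exp (a • Y) := by
  rw [IsNilpotent.exp_eq_sum (k := m + 1) (by rw [smul_pow, hY.pow_eq_zero, smul_zero])]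
  ext p s
  rw [expY, lowerSeries_apply, Matrix.sum_apply]
  have hterm : ∀ k, (((k.factorial : ℚ)⁻¹ • (a • Y) ^ k : Matrix _ _ ℂ)) p s =
      a ^ k / k.factorial * (Y ^ k) p s := by
    intro k
    rw [smul_pow, Matrix.smul_apply, Matrix.smul_apply, smul_eq_mul, Rat.smul_def]
    push_cast; ring
  simp_rw [hterm]
  have := p.deg_le
  split_ifs with h
  · rw [Finset.sum_eq_single (p.deg - s.deg)]
    · intro k _ hk
      rw [hY.pow_apply_eq_zero (by omega), mul_zero]
    · intro h'
      exact absurd (Finset.mem_range.mpr (by omega)) h'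
  · rw [Finset.sum_eq_zero]
    intro k _
    rw [hY.pow_apply_eq_zero (by omega), mul_zero]

theorem expY_mul (hY : IsBlockSubdiagonal Y) (a b : ℂ) : expY Y a * expY Y b = expY Y (a + b) := by
  have hn : ∀ c : ℂ, IsNilpotent (c • Y) := fun c =>
    ⟨m + 1, by rw [smul_pow, hY.pow_eq_zero, smul_zero]⟩
  rw [expY_eq_exp hY, expY_eq_exp hY, expY_eq_exp hY, add_smul,
    IsNilpotent.exp_add_of_commute _ (hn a) (hn b)]
  exact ((Commute.refl Y).smul_left a).smul_right b

theorem expY_zero (hY : IsBlockSubdiagonal Y) : expY Y 0 = 1 := by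
  rw [expY_eq_exp hY, zero_smul, IsNilpotent.exp_zero]

/-- The grading operator `t ^ j` on `ℂ^{d j}`. -/
def grade (t : ℂ) : BlockMatrix d := diagonal fun p => t ^ p.deg

theorem grade_mul (s t : ℂ) : (grade s : BlockMatrix d) * grade t =
    grade (s * t) := by
  simp [grade, mul_pow]

theorem grade_one : (grade 1 : BlockMatrix d) = 1 := by
  simp [grade]

theorem grade_conjTranspose (t : ℂ) : (grade t : BlockMatrix d)ᴴ =
    grade (conj t) := by
  simp [grade, diagonal_conjTranspose, Pi.star_def]

theorem grade_mul_apply (t : ℂ) (A : BlockMatrix d) (p q : BlockIndex d) :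
    (grade t * A : BlockMatrix d) p q = t ^ p.deg * A p q := by
  rw [grade, diagonal_mul]

theorem mul_grade_apply (t : ℂ) (A : BlockMatrix d) (p q : BlockIndex d) :
    (A * grade t : BlockMatrix d) p q = A p q * t ^ q.deg := by
  rw [grade, mul_diagonal]

/-- Conjugating Y by the grading operator rescales it to tY; written without inverses, the relation
also covers t = 0. -/
theorem grade_mul_expY (t a : ℂ) : grade t * expY Y a = expY Y (t * a) * grade t := by
  ext p s
  rw [grade_mul_apply, mul_grade_apply, expY, expY, lowerSeries_apply, lowerSeries_apply]
  split_ifs with h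
  · obtain ⟨k, hk⟩ := Nat.exists_eq_add_of_le h
    rw [hk, Nat.add_sub_cancel_left, mul_pow, pow_add]; ring
  · simp

/-- The kernel `(1 - z w̄)^{-λ} D exp(w̄ Y) exp(z Y^*) D`, `D = (1 - z w̄)^{-j}` on `ℂ^{d j}`. -/
def kernelMatrix (lam : ℝ) (Y : BlockMatrix d) (z w : ℂ) :
    BlockMatrix d :=
  Complex.exp (-lam * Complex.log (1 - z * conj w)) •
    (grade (1 - z * conj w)⁻¹ * expY Y (conj w) * (expY Y (conj z))ᴴ *
      grade (1 - z * conj w)⁻¹)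

theorem kernelMatrix_zero_right (hY : IsBlockSubdiagonal Y) (lam : ℝ) (z : ℂ) :
    kernelMatrix lam Y z 0 = (expY Y (conj z))ᴴ := by
  simp [kernelMatrix, expY_zero hY, grade_one]

theorem norm_mul_conj_lt_one (z w : 𝔻) : ‖(z : ℂ) * conj (w : ℂ)‖ < 1 := by
  rw [norm_mul, RCLike.norm_conj]
  calc ‖(z : ℂ)‖ * ‖(w : ℂ)‖ ≤ ‖(z : ℂ)‖ * 1 :=
        mul_le_mul_of_nonneg_left w.norm_lt_one.le (norm_nonneg _)
    _ < 1 := by rw [mul_one]; exact z.norm_lt_one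

theorem one_sub_mul_conj_mem_slitPlane (z w : 𝔻) :
    1 - (z : ℂ) * conj (w : ℂ) ∈ Complex.slitPlane := by
  rw [sub_eq_add_neg]
  apply Complex.mem_slitPlane_of_norm_lt_one
  rw [norm_neg]
  exact norm_mul_conj_lt_one z w

theorem one_sub_mul_conj_ne_zero (z w : 𝔻) : 1 - (z : ℂ) * conj (w : ℂ) ≠ 0 :=
  Complex.slitPlane_ne_zero (one_sub_mul_conj_mem_slitPlane z w)

theorem kernelMatrix_conjTranspose (lam : ℝ) (Y : BlockMatrix d)
    (z w : 𝔻) : (kernelMatrix lam Y z w)ᴴ = kernelMatrix lam Y w z := by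
  have h1 : conj (1 - (z : ℂ) * conj (w : ℂ)) = 1 - (w : ℂ) * conj (z : ℂ) := by
    simp [mul_comm]
  have h2 : conj (Complex.log (1 - (z : ℂ) * conj (w : ℂ))) =
      Complex.log (1 - (w : ℂ) * conj (z : ℂ)) := by
    rw [← Complex.log_conj _ (Complex.slitPlane_arg_ne_pi (one_sub_mul_conj_mem_slitPlane z w)), h1]
  have h3 : star (Complex.exp (-lam * Complex.log (1 - (z : ℂ) * conj (w : ℂ)))) =
      Complex.exp (-lam * Complex.log (1 - (w : ℂ) * conj (z : ℂ))) := by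
    rw [← h2, ← starRingEnd_apply, ← Complex.exp_conj]; simp
  rw [kernelMatrix, kernelMatrix, conjTranspose_smul, h3]
  simp only [conjTranspose_mul, grade_conjTranspose, conjTranspose_conjTranspose, map_inv₀, h1,
    Matrix.mul_assoc]

/-- The coefficient of `(z w̄) ^ N` in `z ^ p w̄ ^ q` times the `(p, q)` entry of the kernel. -/
def gramMatrix (lam : ℝ) (Y : BlockMatrix d) (N : ℕ) :
    BlockMatrix d :=
  of fun p q => ∑ r ∈ Finset.range (min p.deg q.deg + 1),
    (((if p.deg + q.deg ≤ N + r then binom (lam + p.deg + q.deg) (N + r - p.deg - q.deg) /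
      ((p.deg - r).factorial * (q.deg - r).factorial) else 0 : ℝ)) : ℂ) *
      (Y ^ (p.deg - r) * levelProj r * (Y ^ (q.deg - r))ᴴ : BlockMatrix d) p q

theorem gramMatrix_apply (lam : ℝ) (Y : BlockMatrix d) (N : ℕ)
    (p q : BlockIndex d) : gramMatrix lam Y N p q =
    ∑ r ∈ Finset.range (min p.deg q.deg + 1),
    (((if p.deg + q.deg ≤ N + r then binom (lam + p.deg + q.deg) (N + r - p.deg - q.deg) /
      ((p.deg - r).factorial * (q.deg - r).factorial) else 0 : ℝ)) : ℂ) *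
      (Y ^ (p.deg - r) * levelProj r * (Y ^ (q.deg - r))ᴴ : BlockMatrix d) p q := rfl

/-- This makes the truncated exponents N - p and N - q harmless: wherever they truncate, the
coefficient is zero. -/
theorem gramMatrix_apply_eq_zero (lam : ℝ) (Y : BlockMatrix d) {N : ℕ}
    {p q : BlockIndex d} (h : N < p.deg ∨ N < q.deg) : gramMatrix lam Y N p q = 0 := by
  rw [gramMatrix_apply]
  refine Finset.sum_eq_zero fun r hr => ?_
  rw [if_neg (by simp at hr; omega)]
  simp

/-- The identity between the two exponentials is split into the projections `levelProj r`. -/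
theorem kernelMatrix_apply (lam : ℝ) (Y : BlockMatrix d) (z w : 𝔻)
    (p q : BlockIndex d) : kernelMatrix lam Y z w p q =
    ∑ r ∈ Finset.range (min p.deg q.deg + 1),
      Complex.exp (-(lam + p.deg + q.deg : ℝ) * Complex.log (1 - z * conj (w : ℂ))) *
      (conj (w : ℂ) ^ (p.deg - r) / (p.deg - r).factorial *
        ((z : ℂ) ^ (q.deg - r) / (q.deg - r).factorial) *
      (Y ^ (p.deg - r) * levelProj r * (Y ^ (q.deg - r))ᴴ : BlockMatrix d) p q) := by
  have h0 := one_sub_mul_conj_ne_zero z w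
  rw [kernelMatrix, Matrix.smul_apply, mul_grade_apply, Matrix.mul_assoc, grade_mul_apply, expY,
    expY, ← Matrix.mul_one (lowerSeries Y _),
    lowerSeries_mul_mul_conjTranspose _ _ 1 levelProj one_apply_eq_levelProj
      (fun i s t h => levelProj_apply_eq_zero h), Finset.mul_sum, Finset.sum_mul, Finset.smul_sum]
  refine Finset.sum_congr rfl fun r _ => ?_
  have h1 : Complex.exp (-(lam + p.deg + q.deg : ℝ) * Complex.log (1 - z * conj (w : ℂ))) =
      Complex.exp (-lam * Complex.log (1 - z * conj (w : ℂ))) *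
        ((1 - z * conj (w : ℂ))⁻¹ ^ p.deg * (1 - z * conj (w : ℂ))⁻¹ ^ q.deg) := by
    rw [← pow_add]
    nth_rewrite 3 [← Complex.exp_log h0]
    rw [← Complex.exp_neg, ← Complex.exp_nat_mul, ← Complex.exp_add]
    congr 1; push_cast; ring
  rw [h1, smul_eq_mul]
  simp only [map_div₀, map_pow, Complex.conj_conj, map_natCast]
  ring

/-- The power series expansion of the kernel. -/
theorem hasSum_kernelMatrix (lam : ℝ) (Y : BlockMatrix d) (z w : 𝔻)
    (p q : BlockIndex d) :
    HasSum (fun N : ℕ => gramMatrix lam Y N p q * (z : ℂ) ^ (N - p.deg) * conj (w : ℂ) ^ (N - q.deg))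
      (kernelMatrix lam Y z w p q) := by
  rw [kernelMatrix_apply]
  simp_rw [gramMatrix_apply, Finset.sum_mul]
  refine hasSum_sum fun r hr => ?_
  have hr' : r ≤ p.deg ∧ r ≤ q.deg := by simp at hr; omega
  have hs := ((hasSum_binom (lam + p.deg + q.deg) (norm_mul_conj_lt_one z w)).mul_right
    (conj (w : ℂ) ^ (p.deg - r) / (p.deg - r).factorial *
        ((z : ℂ) ^ (q.deg - r) / (q.deg - r).factorial) *
      (Y ^ (p.deg - r) * levelProj r * (Y ^ (q.deg - r))ᴴ : BlockMatrix d) p q))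
  -- The n-th binomial term carries z^(n + q - r) w̄^(n + p - r), which is degree N = n + p + q - r.
  have hinj : Function.Injective fun n : ℕ => n + (p.deg + q.deg - r) := add_left_injective _
  rw [← hinj.hasSum_iff]
  · refine hs.congr_fun fun n => ?_
    simp only [Function.comp_apply]
    rw [if_pos (by omega), show n + (p.deg + q.deg - r) + r - p.deg - q.deg = n by omega,
      show n + (p.deg + q.deg - r) - p.deg = n + (q.deg - r) by omega,
      show n + (p.deg + q.deg - r) - q.deg = n + (p.deg - r) by omega, mul_pow, pow_add, pow_add]
    push_cast
    ring
  · intro N hN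
    rw [if_neg]
    · simp
    · intro h
      exact hN ⟨N - (p.deg + q.deg - r), by simp only; omega⟩

end BlockAlgebra

/-! ### Factorization of the Gram matrices through weighted Bergman spaces. -/

section Factorization

variable {m : ℕ} {d : Fin (m + 1) → ℕ} {Y : BlockMatrix d}

/-- The constants `1 / (k! (λ + 2 i)_k)` of the intertwining operator onto the bundle. -/
def intertwiner (lam : ℝ) (i k : ℕ) : ℝ := 1 / (k.factorial * rising (lam + 2 * i) k)

@[simp] theorem intertwiner_zero (lam : ℝ) (i : ℕ) : intertwiner lam i 0 = 1 := by
  simp [intertwiner]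

/-- The Hermitian matrices on the summands `ℂ^{d n}` which make the direct sum of weighted Bergman
kernels induce the identity on the fibre over `0`. -/
def levelGram (lam : ℝ) (Y : BlockMatrix d) (n : ℕ) : BlockMatrix d :=
  levelProj n - ∑ i : Fin n, (intertwiner lam i (n - i) : ℂ) •
    (Y ^ (n - (i : ℕ)) * levelGram lam Y i * (Y ^ (n - (i : ℕ)))ᴴ)
termination_by n
decreasing_by exact i.2

theorem levelGram_eq (lam : ℝ) (Y : BlockMatrix d) (n : ℕ) : levelGram lam Y n =
    levelProj n - ∑ i ∈ Finset.range n, (intertwiner lam i (n - i) : ℂ) •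
      (Y ^ (n - i) * levelGram lam Y i * (Y ^ (n - i))ᴴ) := by
  rw [levelGram, Fin.sum_univ_eq_sum_range
    (fun i => (intertwiner lam i (n - i) : ℂ) •
      (Y ^ (n - i) * levelGram lam Y i * (Y ^ (n - i))ᴴ))]

theorem levelProj_eq_sum (lam : ℝ) (Y : BlockMatrix d) (n : ℕ) : (levelProj n : BlockMatrix d) =
    ∑ i ∈ Finset.range (n + 1), (intertwiner lam i (n - i) : ℂ) •
      (Y ^ (n - i) * levelGram lam Y i * (Y ^ (n - i))ᴴ) := by
  rw [Finset.sum_range_succ, Nat.sub_self, levelGram_eq lam Y n]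
  simp

theorem levelGram_isHermitian (lam : ℝ) (Y : BlockMatrix d) (n : ℕ) :
    (levelGram lam Y n).IsHermitian := by
  induction n using Nat.strong_induction_on with
  | _ n ih =>
    rw [IsHermitian, levelGram_eq, conjTranspose_sub, levelProj_conjTranspose, conjTranspose_sum]
    congr 1
    refine Finset.sum_congr rfl fun i hi => ?_
    rw [conjTranspose_smul, conjTranspose_mul, conjTranspose_mul, conjTranspose_conjTranspose,
      ih i (Finset.mem_range.mp hi), Matrix.mul_assoc]
    simp

theorem levelGram_apply_eq_zero (hY : IsBlockSubdiagonal Y) (lam : ℝ) (n : ℕ)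
    (s t : BlockIndex d) (h : ¬ (s.deg = n ∧ t.deg = n)) : levelGram lam Y n s t = 0 := by
  induction n using Nat.strong_induction_on generalizing s t with
  | _ n ih =>
    rw [levelGram_eq, Matrix.sub_apply, levelProj_apply_eq_zero h, Matrix.sum_apply,
      Finset.sum_eq_zero, sub_zero]
    intro i hi
    have hi' := Finset.mem_range.mp hi
    rw [Matrix.smul_apply, mul_apply, Finset.sum_eq_zero, smul_zero]
    intro b _
    rw [mul_apply, Finset.sum_mul]
    refine Finset.sum_eq_zero fun a _ => ?_
    by_cases h1 : s.deg = a.deg + (n - i)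
    · by_cases h2 : t.deg = b.deg + (n - i)
      · rw [ih i hi' a b (by omega)]; simp
      · rw [conjTranspose_apply, hY.pow_apply_eq_zero h2]; simp
    · rw [hY.pow_apply_eq_zero h1]; simp

/-- The block diagonal matrix with the blocks `levelGram`. -/
def fullGram (lam : ℝ) (Y : BlockMatrix d) : BlockMatrix d := of fun s t => levelGram lam Y s.deg s t

/-- The square of the norm of `z ^ (N - i)` in the `i`-th weighted Bergman space, up to the
constants absorbed by `truncation`. -/
def bergmanCoeff (lam : ℝ) (N i : ℕ) : ℝ := (N - i).factorial * rising (lam + 2 * i) (N - i)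

theorem bergmanCoeff_pos {lam : ℝ} (hl : 0 < lam) (N i : ℕ) : 0 < bergmanCoeff lam N i :=
  mul_pos (by positivity) (rising_pos (by positivity) _)

/-- `fullGram` with the `i`-th block scaled by `bergmanCoeff lam N i`. -/
def scaledGram (lam : ℝ) (Y : BlockMatrix d) (N : ℕ) : BlockMatrix d :=
  of fun s t => (bergmanCoeff lam N s.deg : ℂ) * levelGram lam Y s.deg s t

/-- The diagonal matrix `1 / (N - p)!` for `p ≤ N`, and `0` for `p > N`. -/
def truncation (N : ℕ) : BlockMatrix d :=
  diagonal fun p => if p.deg ≤ N then ((1 / (N - p.deg).factorial : ℝ) : ℂ) else 0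

theorem truncation_conjTranspose (N : ℕ) : (truncation N : BlockMatrix d)ᴴ = truncation N := by
  rw [truncation, diagonal_conjTranspose]
  congr 1; funext s
  rw [Pi.star_apply]
  split_ifs <;> simp

/-- The matrix of the intertwining operator. -/
def intertwinerMatrix (lam : ℝ) (Y : BlockMatrix d) : BlockMatrix d :=
  lowerSeries Y fun i k => (intertwiner lam i k : ℂ)

/-- The matrix is block lower unipotent. The transpose is taken because `BlockTriangular` means
upper triangular. -/
theorem intertwinerMatrix_isUnit (lam : ℝ) (Y : BlockMatrix d) :
    IsUnit (intertwinerMatrix lam Y) := by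
  rw [isUnit_iff_isUnit_det, ← det_transpose]
  have hc : ∀ i : ℕ, ((intertwiner lam i 0 : ℝ) : ℂ) = 1 := by simp
  have hb : (intertwinerMatrix lam Y)ᵀ.BlockTriangular BlockIndex.deg := by
    intro p s h
    rw [transpose_apply, intertwinerMatrix, lowerSeries_apply_of_lt _ h]
  rw [hb.det]
  have h1 : ∀ k, (intertwinerMatrix lam Y)ᵀ.toSquareBlock BlockIndex.deg k = 1 := by
    intro k
    ext p s
    have h2 := lowerSeries_apply_of_eq (Y := Y)
      (c := fun i k => (intertwiner lam i k : ℂ)) hc (s.2.trans p.2.symm)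
    simp only [toSquareBlock_def, of_apply, transpose_apply]
    refine h2.trans ?_
    simp [one_apply, Subtype.ext_iff, eq_comm]
  simp [h1]

/-- For λ > 0 the scalars `bergmanCoeff` are positive, and scaling each diagonal block is a
congruence by their square roots. -/
theorem posDef_scaledGram_iff (hY : IsBlockSubdiagonal Y) {lam : ℝ} (hl : 0 < lam) (N : ℕ) :
    (scaledGram lam Y N).PosDef ↔ (fullGram lam Y).PosDef := by
  set S : BlockMatrix d := diagonal fun s => ((√(bergmanCoeff lam N s.deg) : ℝ) : ℂ) with hS
  have hU : IsUnit S := by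
    rw [isUnit_iff_isUnit_det, det_diagonal, isUnit_iff_ne_zero, Finset.prod_ne_zero_iff]
    intro s _
    exact Complex.ofReal_ne_zero.mpr (Real.sqrt_pos.mpr (bergmanCoeff_pos hl _ _)).ne'
  have hstar : star S = S := by
    rw [star_eq_conjTranspose, hS, diagonal_conjTranspose]
    congr 1; funext s; simp
  have hE : scaledGram lam Y N = S * fullGram lam Y * star S := by
    ext s t
    rw [hstar, hS, mul_diagonal, diagonal_mul]
    simp only [scaledGram, fullGram, of_apply]
    by_cases h : t.deg = s.deg
    · have h2 := Real.mul_self_sqrt (bergmanCoeff_pos hl N s.deg).le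
      rw [h, ← h2]
      push_cast
      rw [h2]; ring
    · rw [levelGram_apply_eq_zero hY lam s.deg s t (by omega)]; ring
  rw [hE, IsUnit.posDef_star_right_conjugate_iff hU]

/-- Rewrite each `levelProj r` through the recursion defining `levelGram` and exchange the sums over
r and i. For fixed i the scalar sum is `sum_binom_mul` with λ, p, q, N replaced by λ + 2i, p - i, q
- i, N - i. -/
theorem gramMatrix_eq (hY : IsBlockSubdiagonal Y) {lam : ℝ} (hl : 0 < lam) (N : ℕ) :
    gramMatrix lam Y N = truncation N *
      (intertwinerMatrix lam Y * scaledGram lam Y N * (intertwinerMatrix lam Y)ᴴ) *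
      truncation N := by
  ext p q
  rw [truncation, mul_diagonal, diagonal_mul]
  by_cases hpq : p.deg ≤ N ∧ q.deg ≤ N
  swap
  · rw [gramMatrix_apply_eq_zero _ _ (by omega)]
    by_cases hp : p.deg ≤ N
    · rw [if_neg (show ¬ q.deg ≤ N by omega), mul_zero]
    · rw [if_neg hp]; simp
  obtain ⟨hp, hq⟩ := hpq
  rw [if_pos hp, if_pos hq, intertwinerMatrix,
    lowerSeries_mul_mul_conjTranspose _ _ (scaledGram lam Y N)
      (fun i => (bergmanCoeff lam N i : ℂ) • levelGram lam Y i) (fun s t => rfl)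
      (fun i s t h => by rw [Matrix.smul_apply, levelGram_apply_eq_zero hY lam i s t h, smul_zero]),
    gramMatrix_apply, Finset.mul_sum, Finset.sum_mul]
  have h1 : ∀ r ∈ Finset.range (min p.deg q.deg + 1),
      (Y ^ (p.deg - r) * levelProj r * (Y ^ (q.deg - r))ᴴ : BlockMatrix d) p q =
      ∑ i ∈ Finset.range (r + 1), (intertwiner lam i (r - i) : ℂ) *
        (Y ^ (p.deg - i) * levelGram lam Y i * (Y ^ (q.deg - i))ᴴ : BlockMatrix d) p q := by
    intro r hr
    rw [levelProj_eq_sum lam Y r, Matrix.mul_sum, Matrix.sum_mul, Matrix.sum_apply]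
    refine Finset.sum_congr rfl fun i hi => ?_
    have e1 : p.deg - i = (p.deg - r) + (r - i) := by simp at hr hi; omega
    have e2 : q.deg - i = (q.deg - r) + (r - i) := by simp at hr hi; omega
    rw [Matrix.mul_smul, Matrix.smul_mul, Matrix.smul_apply, smul_eq_mul, e1, e2, pow_add, pow_add,
      conjTranspose_mul]
    simp only [Matrix.mul_assoc]
  rw [Finset.sum_congr rfl fun r hr => by rw [h1 r hr, Finset.mul_sum],
    Finset.sum_comm' (t' := Finset.range (min p.deg q.deg + 1))
      (s' := fun i => Finset.Ico i (min p.deg q.deg + 1)) (by intro r i; simp; omega)]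
  refine Finset.sum_congr rfl fun i hi => ?_
  have hi' : i ≤ p.deg ∧ i ≤ q.deg := by simp at hi; omega
  have hl' : 0 < lam + 2 * i := by positivity
  have key := sum_binom_mul hl' (p := p.deg - i) (q := q.deg - i) (N := N - i) (by omega) (by omega)
  rw [Matrix.mul_smul, Matrix.smul_mul, Matrix.smul_apply, smul_eq_mul,
    Finset.sum_congr rfl fun r _ => (mul_assoc _ _ _).symm, ← Finset.sum_mul]
  have key2 : ∑ r ∈ Finset.Ico i (min p.deg q.deg + 1),
      (((if p.deg + q.deg ≤ N + r then binom (lam + p.deg + q.deg) (N + r - p.deg - q.deg) /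
      ((p.deg - r).factorial * (q.deg - r).factorial) else 0 : ℝ)) : ℂ) *
        (intertwiner lam i (r - i) : ℂ) =
      ((intertwiner lam i (p.deg - i) * intertwiner lam i (q.deg - i) * bergmanCoeff lam N i /
        ((N - p.deg).factorial * (N - q.deg).factorial) : ℝ) : ℂ) := by
    rw [intertwiner, intertwiner, bergmanCoeff, show N - p.deg = N - i - (p.deg - i) by omega,
      show N - q.deg = N - i - (q.deg - i) by omega, ← key, Finset.sum_Ico_eq_sum_range,
      show min p.deg q.deg + 1 - i = min (p.deg - i) (q.deg - i) + 1 by omega]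
    push_cast
    refine Finset.sum_congr rfl fun r hr => ?_
    have e1 : lam + p.deg + q.deg = lam + 2 * i + ((p.deg - i : ℕ) : ℝ) + ((q.deg - i : ℕ) : ℝ) := by
      rw [Nat.cast_sub hi'.1, Nat.cast_sub hi'.2]; ring
    rw [e1, show p.deg - (i + r) = p.deg - i - r by omega,
      show q.deg - (i + r) = q.deg - i - r by omega, show i + r - i = r by omega, intertwiner]
    by_cases hc : p.deg + q.deg ≤ N + (i + r)
    · rw [if_pos hc, if_pos (by omega),
        show N + (i + r) - p.deg - q.deg = N - i + r - (p.deg - i) - (q.deg - i) by omega]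
      push_cast; ring
    · rw [if_neg hc, if_neg (by omega)]; simp
  rw [key2]
  have hconj : ∀ x : ℝ, conj (x : ℂ) = x := Complex.conj_ofReal
  rw [hconj]
  push_cast
  ring

theorem posDef_middle_iff (hY : IsBlockSubdiagonal Y) {lam : ℝ} (hl : 0 < lam) (N : ℕ) :
    (intertwinerMatrix lam Y * scaledGram lam Y N * (intertwinerMatrix lam Y)ᴴ).PosDef ↔
      (fullGram lam Y).PosDef := by
  rw [← posDef_scaledGram_iff hY hl N, ← star_eq_conjTranspose,
    IsUnit.posDef_star_right_conjugate_iff (intertwinerMatrix_isUnit lam Y)]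

/-- At degree m no component is truncated, so the outer factor is invertible and this one Gram
matrix decides positivity. -/
theorem posDef_fullGram_iff (hY : IsBlockSubdiagonal Y) {lam : ℝ} (hl : 0 < lam) :
    (fullGram lam Y).PosDef ↔ (gramMatrix lam Y m).PosDef := by
  have hU : IsUnit (truncation m : BlockMatrix d) := by
    rw [isUnit_iff_isUnit_det, truncation, det_diagonal, isUnit_iff_ne_zero,
      Finset.prod_ne_zero_iff]
    intro s _
    rw [if_pos s.deg_le]
    exact Complex.ofReal_ne_zero.mpr (by positivity)
  have hstar : star (truncation m : BlockMatrix d) = truncation m := truncation_conjTranspose m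
  rw [gramMatrix_eq hY hl m, ← posDef_middle_iff hY hl m]
  nth_rewrite 2 [← hstar]
  rw [IsUnit.posDef_star_right_conjugate_iff hU]

end Factorization

/-! ### The Möbius action and the branch of log (c z + d). -/

namespace CoverG

variable (g : CoverG)

/-- The denominator `c z + d` of the action. -/
def denom (z : 𝔻) : ℂ := conj g.b * z + conj g.a

theorem exp_logDenom_eq (z : 𝔻) : Complex.exp (g.logDenom z) = g.denom z := g.exp_logDenom z

theorem denom_ne_zero (z : 𝔻) : g.denom z ≠ 0 := by
  rw [← exp_logDenom_eq]; exact Complex.exp_ne_zero _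

theorem coe_act (z : 𝔻) : (g.act z : ℂ) = (g.a * z + g.b) / g.denom z := rfl

theorem mul_conj_sub : g.a * conj g.a - g.b * conj g.b = 1 := by
  rw [Complex.mul_conj, Complex.mul_conj, ← Complex.ofReal_sub, g.det_eq, Complex.ofReal_one]

theorem one_sub_act_mul_conj (z w : 𝔻) : 1 - (g.act z : ℂ) * conj (g.act w : ℂ) =
    (1 - z * conj (w : ℂ)) / (g.denom z * conj (g.denom w)) := by
  have h1 := g.denom_ne_zero z
  have h2 : conj (g.denom w) ≠ 0 := (map_ne_zero _).mpr (g.denom_ne_zero w)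
  rw [coe_act, coe_act, map_div₀, eq_div_iff (mul_ne_zero h1 h2)]
  field_simp
  simp only [denom, map_add, map_mul, Complex.conj_conj]
  linear_combination (1 - z * conj (w : ℂ)) * g.mul_conj_sub

theorem continuous_act : Continuous fun z => (g.act z : ℂ) := by
  have h1 : Continuous fun z : 𝔻 => (z : ℂ) := Complex.UnitDisc.continuous_coe
  have h2 : Continuous g.denom := by unfold denom; fun_prop
  simp_rw [coe_act]
  exact Continuous.div (by fun_prop) h2 g.denom_ne_zero

theorem preconnectedSpace_unitDisc : PreconnectedSpace 𝔻 := by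
  have h : IsPreconnected (Metric.ball (0 : ℂ) 1) := (convex_ball 0 1).isPreconnected
  have h2 : Set.range (fun z : 𝔻 => (z : ℂ)) = Metric.ball (0 : ℂ) 1 := by
    ext z
    simp only [Set.mem_range, mem_ball_zero_iff]
    exact ⟨fun ⟨w, hw⟩ => hw ▸ w.norm_lt_one, fun hz => ⟨Complex.UnitDisc.mk z hz, rfl⟩⟩
  rw [← h2] at h
  exact ⟨by
    rw [← Complex.UnitDisc.isEmbedding_coe.isInducing.isPreconnected_image, Set.image_univ]
    exact h⟩

/-- Exponentiated, this is `one_sub_act_mul_conj`. The difference of the two sides is therefore a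
continuous function of z with values in 2πiℤ, and it vanishes at z = w, where its imaginary part is
zero; the disc is connected. -/
theorem logDenom_add_conj (z w : 𝔻) :
    g.logDenom z + conj (g.logDenom w) +
      Complex.log (1 - (g.act z : ℂ) * conj (g.act w : ℂ)) =
    Complex.log (1 - z * conj (w : ℂ)) := by
  have := preconnectedSpace_unitDisc
  set φ : 𝔻 → ℂ := fun z => g.logDenom z + conj (g.logDenom w) +
      Complex.log (1 - (g.act z : ℂ) * conj (g.act w : ℂ)) -
      Complex.log (1 - z * conj (w : ℂ)) with hφ
  have hcont : Continuous φ := by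
    have h1 : Continuous fun z : 𝔻 => (z : ℂ) := Complex.UnitDisc.continuous_coe
    have h2 := g.continuous_act
    have h3 := g.continuous_logDenom
    exact ((h3.add continuous_const).add (Continuous.clog (by fun_prop)
      fun z => one_sub_mul_conj_mem_slitPlane (g.act z) (g.act w))).sub
      (Continuous.clog (by fun_prop) fun z => one_sub_mul_conj_mem_slitPlane z w)
  have hexp : ∀ z, Complex.exp (φ z) = 1 := by
    intro z
    rw [hφ]
    simp only
    rw [Complex.exp_sub, Complex.exp_add, Complex.exp_add, Complex.exp_conj, exp_logDenom_eq,
      exp_logDenom_eq, Complex.exp_log (one_sub_mul_conj_ne_zero _ _),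
      Complex.exp_log (one_sub_mul_conj_ne_zero _ _), one_sub_act_mul_conj]
    have h1 := g.denom_ne_zero z
    have h2 : conj (g.denom w) ≠ 0 := (map_ne_zero _).mpr (g.denom_ne_zero w)
    have h3 := one_sub_mul_conj_ne_zero z w
    field_simp
  have hzero : ∀ z, |(φ z).im| < 1 → φ z = 0 := by
    intro z hz
    obtain ⟨n, hn⟩ := Complex.exp_eq_one_iff.mp (hexp z)
    have h1 : (φ z).im = n * (2 * Real.pi) := by rw [hn]; simp
    have h2 : n = 0 := by
      by_contra h0
      have h3 : (1 : ℝ) ≤ |(n : ℝ)| := by exact_mod_cast Int.one_le_abs h0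
      rw [h1, abs_mul, abs_of_pos (by positivity : (0 : ℝ) < 2 * Real.pi)] at hz
      nlinarith [Real.pi_gt_three]
    rw [hn, h2]; simp
  -- The values are spaced by 2π, so the closed zero set is also described by an open condition.
  have hset : {z | φ z = 0} = {z | |(φ z).im| < 1} := by
    ext z
    exact ⟨fun h => by simp [show φ z = 0 from h], hzero z⟩
  have hclopen : IsClopen {z | φ z = 0} := by
    refine ⟨isClosed_eq hcont continuous_const, ?_⟩
    rw [hset]
    exact isOpen_lt (Complex.continuous_im.comp hcont).abs continuous_const
  have hself : φ w = 0 := by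
    apply hzero
    have hreal : ∀ u : 𝔻, (Complex.log (1 - u * conj (u : ℂ))).im = 0 := by
      intro u
      rw [← Complex.conj_eq_iff_im, ← Complex.log_conj _
        (Complex.slitPlane_arg_ne_pi (one_sub_mul_conj_mem_slitPlane u u))]
      simp [mul_comm]
    have : (φ w).im = 0 := by
      rw [hφ]
      simp [hreal w, hreal (g.act w)]
    simp [this]
  have huniv := hclopen.eq_univ ⟨w, hself⟩
  have hz : z ∈ {z | φ z = 0} := huniv ▸ Set.mem_univ z
  exact sub_eq_zero.mp hz

end CoverG

/-! ### Invariance of the explicit kernel. -/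

section Invariance

variable {m : ℕ} {d : Fin (m + 1) → ℕ} {Y : BlockMatrix d}

/-- In this form the multiplier can be moved through the kernel by the rules for `grade` and `expY`
alone. -/
theorem multiplier_eq (η : ℝ) (Y : BlockMatrix d) (g : CoverG) (z : 𝔻) :
    multiplier η Y g z = Complex.exp (-(2 * η : ℝ) * g.logDenom z) •
      (grade (g.denom z)⁻¹ * expY Y (-g.c) * grade (g.denom z)⁻¹) := by
  ext p q
  rw [Matrix.smul_apply, mul_grade_apply, grade_mul_apply, expY, lowerSeries_apply]
  simp only [multiplier, of_apply]
  change (if q.deg ≤ p.deg then (1 / (Nat.factorial (p.deg - q.deg) : ℂ)) *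
    (-g.c) ^ (p.deg - q.deg) * g.derivPow (η + ((p.deg : ℝ) + (q.deg : ℝ)) / 2) z *
    (Y ^ (p.deg - q.deg)) p q else 0) = _
  split_ifs with h
  · have h1 : g.derivPow (η + ((p.deg : ℝ) + (q.deg : ℝ)) / 2) z =
        Complex.exp (-(2 * η : ℝ) * g.logDenom z) *
          ((g.denom z)⁻¹ ^ p.deg * (g.denom z)⁻¹ ^ q.deg) := by
      rw [← pow_add, ← g.exp_logDenom_eq, ← Complex.exp_neg, ← Complex.exp_nat_mul,
        ← Complex.exp_add, CoverG.derivPow]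
      congr 1; push_cast; ring
    rw [h1, smul_eq_mul]; ring
  · simp

/-- The holomorphic half of the invariance: the multiplier absorbs the left half of the kernel at
(gz, gw). The right half follows by taking adjoints with z and w exchanged. -/
theorem multiplier_factor (hY : IsBlockSubdiagonal Y) (g : CoverG) (z w : 𝔻) :
    grade (g.denom z)⁻¹ * expY Y (-g.c) * grade (g.denom z)⁻¹ *
      (grade (1 - (g.act z : ℂ) * conj (g.act w : ℂ))⁻¹ * expY Y (conj (g.act w : ℂ))) =
    expY Y ((1 - z * conj (w : ℂ))⁻¹ * conj (w : ℂ)) *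
      grade ((g.denom z)⁻¹ * conj (g.denom w) * (1 - z * conj (w : ℂ))⁻¹) := by
  have h1 := g.denom_ne_zero z
  have h2 : conj (g.denom w) ≠ 0 := (map_ne_zero _).mpr (g.denom_ne_zero w)
  have h3 := one_sub_mul_conj_ne_zero z w
  set u := (1 - z * conj (w : ℂ))⁻¹ with hu
  have e1 : (g.denom z)⁻¹ * (1 - (g.act z : ℂ) * conj (g.act w : ℂ))⁻¹ =
      conj (g.denom w) * u := by
    rw [g.one_sub_act_mul_conj, hu]; field_simp
  -- The exponents of the two exponentials of Y add up to a multiple of w̄; after clearing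
  -- denominators this is elementary algebra.
  have e2 : -g.c + conj (g.denom w) * u * conj (g.act w : ℂ) = g.denom z * (u * conj (w : ℂ)) := by
    rw [g.coe_act, map_div₀, hu]
    field_simp
    simp only [CoverG.denom, CoverG.c, map_add, map_mul]
    ring
  calc _ = grade (g.denom z)⁻¹ * (expY Y (-g.c) * ((grade (g.denom z)⁻¹ *
        grade (1 - (g.act z : ℂ) * conj (g.act w : ℂ))⁻¹) * expY Y (conj (g.act w : ℂ)))) := by
        simp only [Matrix.mul_assoc]
    _ = grade (g.denom z)⁻¹ * expY Y (g.denom z * (u * conj (w : ℂ))) *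
        grade (conj (g.denom w) * u) := by
        rw [grade_mul, e1, grade_mul_expY, ← Matrix.mul_assoc (expY Y _), expY_mul hY, e2,
          Matrix.mul_assoc]
    _ = _ := by
        rw [grade_mul_expY, Matrix.mul_assoc, grade_mul, inv_mul_cancel_left₀ h1, ← mul_assoc]

theorem kernelMatrix_invariant (hY : IsBlockSubdiagonal Y) (η : ℝ) (g : CoverG) (z w : 𝔻) :
    kernelMatrix (2 * η) Y z w = multiplier η Y g z *
      (kernelMatrix (2 * η) Y (g.act z) (g.act w) * (multiplier η Y g w)ᴴ) := by
  have hsym : ∀ x y : 𝔻, conj (1 - (x : ℂ) * conj (y : ℂ)) = 1 - (y : ℂ) * conj (x : ℂ) := by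
    intro x y; simp [mul_comm]
  have h1 := multiplier_factor hY g z w
  have h2 := congrArg conjTranspose (multiplier_factor hY g w z)
  simp only [conjTranspose_mul, grade_conjTranspose, map_mul, map_inv₀, hsym,
    Complex.conj_conj] at h2
  -- The scalar factors match because the chosen branches of the logarithm do.
  have hs : Complex.exp (-((2 * η : ℝ) : ℂ) * g.logDenom z) *
      Complex.exp (-((2 * η : ℝ) : ℂ) * Complex.log (1 - (g.act z : ℂ) * conj (g.act w : ℂ))) *
      star (Complex.exp (-((2 * η : ℝ) : ℂ) * g.logDenom w)) =
      Complex.exp (-((2 * η : ℝ) : ℂ) * Complex.log (1 - z * conj (w : ℂ))) := by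
    rw [← g.logDenom_add_conj z w, ← starRingEnd_apply, ← Complex.exp_conj, ← Complex.exp_add,
      ← Complex.exp_add]
    congr 1
    simp only [map_mul, map_neg, Complex.conj_ofReal]
    ring
  have hz := g.denom_ne_zero z
  have hw : conj (g.denom w) ≠ 0 := (map_ne_zero _).mpr (g.denom_ne_zero w)
  have h3 : grade (1 - z * conj (w : ℂ))⁻¹ * expY Y (conj (w : ℂ)) * (expY Y (conj (z : ℂ)))ᴴ *
        grade (1 - z * conj (w : ℂ))⁻¹ =
      (grade (g.denom z)⁻¹ * expY Y (-g.c) * grade (g.denom z)⁻¹ *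
        (grade (1 - (g.act z : ℂ) * conj (g.act w : ℂ))⁻¹ * expY Y (conj (g.act w : ℂ)))) *
      ((expY Y (conj (g.act z : ℂ)))ᴴ * grade (1 - (g.act z : ℂ) * conj (g.act w : ℂ))⁻¹ *
        (grade (conj (g.denom w))⁻¹ * ((expY Y (-g.c))ᴴ * grade (conj (g.denom w))⁻¹))) := by
    have h4 := congrArg conjTranspose
      (grade_mul_expY (Y := Y) (1 - w * conj (z : ℂ))⁻¹ (conj (z : ℂ)))
    simp only [conjTranspose_mul, grade_conjTranspose, map_inv₀, hsym] at h4
    rw [h1, h2, Matrix.mul_assoc, h4, grade_mul_expY]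
    simp only [Matrix.mul_assoc]
    congr 1
    simp only [← Matrix.mul_assoc]
    rw [grade_mul, grade_mul]
    congr 2
    field_simp
  rw [multiplier_eq, multiplier_eq, kernelMatrix, kernelMatrix, h3, ← hs]
  simp only [conjTranspose_smul, conjTranspose_mul, grade_conjTranspose, map_inv₀,
    Matrix.smul_mul, Matrix.mul_smul, smul_smul, Matrix.mul_assoc]
  congr 1
  ring

end Invariance

/-! ### Rotations and transvections, and functions invariant under rotations. -/

namespace CoverG

/-- The rotation `z ↦ exp(i θ) z` with the multiplier `exp(-i θ / 2)`. -/
def rotation (θ : ℝ) : CoverG where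
  a := Complex.exp (θ / 2 * Complex.I)
  b := 0
  det_eq := by
    rw [← Complex.ofReal_ofNat, ← Complex.ofReal_div, Complex.normSq_eq_norm_sq,
      Complex.norm_exp_ofReal_mul_I]
    simp
  logDenom := fun _ => -(θ / 2 * Complex.I)
  continuous_logDenom := continuous_const
  exp_logDenom := fun z => by
    rw [← Complex.exp_conj]
    simp [map_ofNat]

theorem rotation_denom (θ : ℝ) (z : 𝔻) :
    (rotation θ).denom z = Complex.exp (-(θ / 2 * Complex.I)) :=
  ((rotation θ).exp_logDenom_eq z).symm

theorem coe_rotation_act (θ : ℝ) (z : 𝔻) :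
    ((rotation θ).act z : ℂ) = Complex.exp (θ * Complex.I) * z := by
  rw [coe_act, rotation_denom, div_eq_mul_inv, ← Complex.exp_neg, neg_neg]
  simp only [rotation, add_zero]
  rw [mul_right_comm, ← Complex.exp_add]
  congr 2; ring

theorem one_sub_normSq_pos (w : 𝔻) : 0 < 1 - Complex.normSq (w : ℂ) :=
  sub_pos.mpr w.normSq_lt_one

/-- The square root of `1 - |w|²`. -/
def defect (w : 𝔻) : ℝ := √(1 - Complex.normSq (w : ℂ))

theorem defect_pos (w : 𝔻) : 0 < defect w := Real.sqrt_pos.mpr (one_sub_normSq_pos w)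

/-- The transvection `ζ ↦ (ζ - w) / (1 - w̄ ζ)` carrying `w` to `0`. -/
def toZero (w : 𝔻) : CoverG where
  a := ((defect w)⁻¹ : ℝ)
  b := -((defect w)⁻¹ : ℝ) * w
  det_eq := by
    have h := (defect_pos w).ne'
    have h2 : defect w * defect w = 1 - Complex.normSq (w : ℂ) :=
      Real.mul_self_sqrt (one_sub_normSq_pos w).le
    rw [Complex.normSq_mul, Complex.normSq_neg, Complex.normSq_ofReal]
    field_simp
    linarith
  logDenom := fun z => Complex.log (1 - z * conj (w : ℂ)) - (Real.log (defect w) : ℝ)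
  continuous_logDenom := by
    have h1 : Continuous fun z : 𝔻 => (z : ℂ) := Complex.UnitDisc.continuous_coe
    exact (Continuous.clog (by fun_prop) fun z => one_sub_mul_conj_mem_slitPlane z w).sub
      continuous_const
  exp_logDenom := fun z => by
    rw [Complex.exp_sub, Complex.exp_log (one_sub_mul_conj_ne_zero z w), ← Complex.ofReal_exp,
      Real.exp_log (defect_pos w)]
    simp only [map_mul, map_neg, Complex.conj_ofReal]
    push_cast
    ring

theorem toZero_denom (w z : 𝔻) : (toZero w).denom z = (1 - z * conj (w : ℂ)) / (defect w : ℝ) := by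
  simp only [denom, toZero, map_mul, map_neg, Complex.conj_ofReal]
  push_cast
  ring

theorem toZero_act_self (w : 𝔻) : (toZero w).act w = 0 := by
  rw [← Complex.UnitDisc.coe_inj, coe_act, Complex.UnitDisc.coe_zero]
  simp [toZero]

theorem toZero_act_zero (w : 𝔻) : (toZero w).act 0 = -w := by
  have h := Complex.ofReal_ne_zero.mpr (defect_pos w).ne'
  rw [← Complex.UnitDisc.coe_inj, coe_act, toZero_denom]
  simp only [toZero, Complex.UnitDisc.coe_zero, Complex.UnitDisc.coe_neg]
  push_cast
  field_simp
  simp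

end CoverG

/-- A rotation invariant holomorphic function on the disc is constant. -/
theorem eq_apply_zero_of_rotation_invariant {F : ℂ → ℂ} (hF : DifferentiableOn ℂ F (Metric.ball 0 1))
    (hrot : ∀ (θ : ℝ) (z : 𝔻), F (Complex.exp (θ * Complex.I) * z) = F z) (z : 𝔻) :
    F z = F 0 := by
  -- By the mean value property F 0 is the average over the circle through z, on which F is
  -- constant.
  have h1 : Real.circleAverage F 0 ‖(z : ℂ)‖ = F 0 := by
    apply DiffContOnCl.circleAverage
    rw [abs_norm]
    apply DifferentiableOn.diffContOnCl
    refine hF.mono ((Metric.closure_ball_subset_closedBall).trans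
      (Metric.closedBall_subset_ball z.norm_lt_one))
  rw [← h1]
  symm
  apply Real.circleAverage_const_on_circle
  intro x hx
  rw [abs_norm, mem_sphere_zero_iff_norm] at hx
  have h2 : ∀ y : ℂ, ‖y‖ = ‖(z : ℂ)‖ → F y = F ((‖(z : ℂ)‖ : ℝ) : ℂ) := by
    intro y hy
    have h3 := hrot y.arg (Complex.UnitDisc.mk ((‖(z : ℂ)‖ : ℝ) : ℂ) (by simpa using z.norm_lt_one))
    rw [Complex.UnitDisc.coe_mk] at h3
    rw [← h3, ← hy, mul_comm, Complex.norm_mul_exp_arg_mul_I]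
  rw [h2 x hx, h2 z rfl]

/-! ### Uniqueness of the invariant kernel. -/

section Uniqueness

variable {m : ℕ} {d : Fin (m + 1) → ℕ} {Y : BlockMatrix d}

/-- The first column of an invariant kernel is block upper triangular with constant diagonal. -/
theorem kernel_column_apply (hY : IsBlockSubdiagonal Y) {η : ℝ} {κ : 𝔻 → 𝔻 → BlockMatrix d}
    (hinv : ∀ g z w, κ z w = multiplier η Y g z * (κ (g.act z) (g.act w) * (multiplier η Y g w)ᴴ))
    (hhol : ∀ p q, IsHolomorphic fun z => κ z 0 p q) (h0 : κ 0 0 = 1)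
    {p q : BlockIndex d} (h : q.deg ≤ p.deg) {z : 𝔻} (hz : z ≠ 0) :
    κ z 0 p q = (1 : BlockMatrix d) p q := by
  -- Rotations fix 0 and act there by `grade`, so the (p, q) entry picks up the character e^{iθ(p -
  -- q)}.
  have hrot : ∀ (θ : ℝ) (z : 𝔻), κ z 0 p q =
      Complex.exp (θ * Complex.I) ^ (p.deg - q.deg) * κ ((CoverG.rotation θ).act z) 0 p q := by
    intro θ z
    have hact : (CoverG.rotation θ).act 0 = 0 := by
      rw [← Complex.UnitDisc.coe_inj, CoverG.coe_rotation_act]; simp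
    have h1 := hinv (CoverG.rotation θ) z 0
    have hc : (CoverG.rotation θ).c = 0 := by simp [CoverG.c, CoverG.rotation]
    rw [hact, multiplier_eq, multiplier_eq, hc, neg_zero, expY_zero hY, Matrix.mul_one,
      Matrix.mul_one, grade_mul, grade_mul, CoverG.rotation_denom, CoverG.rotation_denom,
      conjTranspose_smul, grade_conjTranspose, Matrix.mul_smul, Matrix.smul_mul, Matrix.mul_smul,
      smul_smul] at h1
    rw [h1, Matrix.smul_apply, grade_mul_apply, mul_grade_apply, smul_eq_mul]
    obtain ⟨k, hk⟩ := Nat.exists_eq_add_of_le h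
    have e1 : (Complex.exp (-(θ / 2 * Complex.I)))⁻¹ * (Complex.exp (-(θ / 2 * Complex.I)))⁻¹ =
        Complex.exp (θ * Complex.I) := by
      rw [← Complex.exp_neg, ← Complex.exp_add]; congr 1; ring
    have e2 : Complex.exp (θ * Complex.I) * conj (Complex.exp (θ * Complex.I)) = 1 := by
      rw [← Complex.exp_conj, ← Complex.exp_add]; simp
    have e3 : Complex.exp (-(2 * η : ℝ) * (CoverG.rotation θ).logDenom z) *
        star (Complex.exp (-(2 * η : ℝ) * (CoverG.rotation θ).logDenom 0)) = 1 := by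
      rw [← starRingEnd_apply, ← Complex.exp_conj, ← Complex.exp_add, Complex.exp_eq_one_iff]
      refine ⟨0, ?_⟩
      simp [CoverG.rotation, map_ofNat]
    rw [e3, e1, one_mul, hk, Nat.add_sub_cancel_left, pow_add]
    have e4 : Complex.exp (θ * Complex.I) ^ q.deg * conj (Complex.exp (θ * Complex.I)) ^ q.deg = 1 := by
      rw [← mul_pow, e2, one_pow]
    linear_combination (Complex.exp (θ * Complex.I) ^ k * κ ((CoverG.rotation θ).act z) 0 p q) * e4
  obtain ⟨F, hF, hFz⟩ := hhol p q
  have hFκ : ∀ z : 𝔻, κ z 0 p q = F z := hFz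
  -- Hence z^(p - q) F is constant. Its value at 0 is zero if p > q, and is the entry of κ 0 0 if p
  -- = q.
  have h1 := eq_apply_zero_of_rotation_invariant (F := fun z => z ^ (p.deg - q.deg) * F z)
    ((differentiableOn_id.pow _).mul hF) (fun θ z => by
      have h2 := hrot θ z
      rw [hFκ, hFκ, CoverG.coe_rotation_act] at h2
      rw [h2, mul_pow]; ring) z
  rw [hFκ]
  have hz' : (z : ℂ) ≠ 0 := fun h => hz (Complex.UnitDisc.coe_eq_zero.mp h)
  rcases h.eq_or_lt with h2 | h2
  · have h3 := hFκ 0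
    rw [h0, Complex.UnitDisc.coe_zero] at h3
    rw [h2, Nat.sub_self, pow_zero, pow_zero, one_mul, one_mul] at h1
    rw [h1, h3]
  · rw [zero_pow (by omega), zero_mul, mul_eq_zero] at h1
    rw [h1.resolve_left (pow_ne_zero _ hz'), one_apply_ne]
    rintro rfl
    exact lt_irrefl _ h2

/-- The transvection sending w to 0 and 0 to -w expresses κ(w, 0)^* through κ(-w, 0). After
multiplication by exp(-w̄ Y), one side is block lower unipotent and the other block upper
triangular, both by `kernel_column_apply`; so both equal the identity. -/
theorem kernel_column_eq (hY : IsBlockSubdiagonal Y) {η : ℝ} {κ : 𝔻 → 𝔻 → BlockMatrix d}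
    (hinv : ∀ g z w, κ z w = multiplier η Y g z * (κ (g.act z) (g.act w) * (multiplier η Y g w)ᴴ))
    (hherm : ∀ z w, (κ z w)ᴴ = κ w z)
    (hhol : ∀ p q, IsHolomorphic fun z => κ z 0 p q) (h0 : κ 0 0 = 1) (w : 𝔻) :
    κ w 0 = (expY Y (conj (w : ℂ)))ᴴ := by
  by_cases hw : w = 0
  · rw [hw, h0, Complex.UnitDisc.coe_zero, map_zero, expY_zero hY, conjTranspose_one]
  have hw' : -w ≠ 0 := by
    intro h
    apply hw
    rw [← Complex.UnitDisc.coe_eq_zero, Complex.UnitDisc.coe_neg, neg_eq_zero] at h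
    exact Complex.UnitDisc.coe_eq_zero.mp h
  have hs : ((CoverG.defect w : ℝ) : ℂ) ≠ 0 :=
    Complex.ofReal_ne_zero.mpr (CoverG.defect_pos w).ne'
  set s : ℂ := ((CoverG.defect w : ℝ) : ℂ) with hsdef
  set g := CoverG.toZero w with hg
  have h1 := hinv g 0 w
  rw [hg, CoverG.toZero_act_zero, CoverG.toZero_act_self, ← hg, ← hherm w 0, multiplier_eq,
    multiplier_eq, conjTranspose_smul, Matrix.mul_smul, Matrix.smul_mul, Matrix.mul_smul,
    smul_smul] at h1
  have e1 : Complex.exp (-(2 * η : ℝ) * g.logDenom 0) *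
      star (Complex.exp (-(2 * η : ℝ) * g.logDenom w)) = 1 := by
    have h2 := g.logDenom_add_conj 0 w
    rw [hg, CoverG.toZero_act_self, ← hg] at h2
    simp only [Complex.UnitDisc.coe_zero, map_zero, mul_zero, zero_mul, sub_zero, Complex.log_one,
      add_zero] at h2
    rw [← starRingEnd_apply, ← Complex.exp_conj, ← Complex.exp_add]
    simp only [map_mul, map_neg, Complex.conj_ofReal]
    rw [← mul_add, h2, mul_zero, Complex.exp_zero]
  have e2 : (g.denom 0)⁻¹ = s := by rw [hg, CoverG.toZero_denom]; simp [hsdef]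
  have e3 : -g.c = s⁻¹ * conj (w : ℂ) := by
    simp [hg, CoverG.c, CoverG.toZero, hsdef]
  rw [e1, one_smul, e2, e3, grade_mul_expY, mul_inv_cancel_left₀ hs, Matrix.mul_assoc (expY Y _),
    grade_mul] at h1
  set M : BlockMatrix d := grade (g.denom w)⁻¹ * expY Y (s⁻¹ * conj (w : ℂ)) *
    grade (g.denom w)⁻¹ with hM
  have hMlow : ∀ a b : BlockIndex d, a.deg < b.deg → M a b = 0 := by
    intro a b hab
    rw [hM, mul_grade_apply, grade_mul_apply, expY, lowerSeries_apply_of_lt _ hab]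
    ring
  have h2 : expY Y (-conj (w : ℂ)) * (κ w 0)ᴴ = grade (s * s) * (κ (-w) 0 * Mᴴ) := by
    rw [h1, Matrix.mul_assoc (expY Y _), ← Matrix.mul_assoc (expY Y (-conj (w : ℂ))), expY_mul hY,
      neg_add_cancel, expY_zero hY, Matrix.one_mul]
  have hX : expY Y (-conj (w : ℂ)) * (κ w 0)ᴴ = 1 := by
    ext p q
    rcases lt_or_ge q.deg p.deg with h | h
    · rw [h2, grade_mul_apply, mul_apply, Finset.sum_eq_zero, mul_zero, one_apply_ne]
      · rintro rfl; exact lt_irrefl _ h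
      · intro r _
        rw [conjTranspose_apply]
        rcases lt_or_ge q.deg r.deg with h3 | h3
        · rw [hMlow q r h3]; simp
        · rw [kernel_column_apply hY hinv hhol h0 (by omega) hw', one_apply_ne]
          · simp
          · rintro rfl; omega
    · have h3 : ∀ r, expY Y (-conj (w : ℂ)) p r * (κ w 0)ᴴ r q =
          (1 : BlockMatrix d) p r * (1 : BlockMatrix d) r q := by
        intro r
        rw [conjTranspose_apply]
        rcases lt_trichotomy p.deg r.deg with h4 | h4 | h4
        · rw [expY, lowerSeries_apply_of_lt _ h4, one_apply_ne]
          · simp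
          · rintro rfl; omega
        · rw [expY, lowerSeries_apply_of_eq (by simp) h4,
            kernel_column_apply hY hinv hhol h0 (by omega) hw, ← conjTranspose_apply,
            conjTranspose_one]
        · rw [kernel_column_apply hY hinv hhol h0 (by omega) hw, one_apply_ne (i := q),
            one_apply_ne (i := p)]
          · simp
          · rintro rfl; omega
          · rintro rfl; omega
      rw [mul_apply, Finset.sum_congr rfl fun r _ => h3 r, ← mul_apply, Matrix.one_mul]
  rw [← conjTranspose_conjTranspose (κ w 0)]
  congr 1
  rw [← Matrix.one_mul (κ w 0)ᴴ, ← expY_zero hY, ← add_neg_cancel (conj (w : ℂ)), ← expY_mul hY,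
    Matrix.mul_assoc, hX, Matrix.mul_one]

/-- The invariant kernel which is the identity at the origin is unique. -/
theorem kernel_eq_kernelMatrix (hY : IsBlockSubdiagonal Y) {η : ℝ} {κ : 𝔻 → 𝔻 → BlockMatrix d}
    (hinv : ∀ g z w, κ z w = multiplier η Y g z * (κ (g.act z) (g.act w) * (multiplier η Y g w)ᴴ))
    (hherm : ∀ z w, (κ z w)ᴴ = κ w z)
    (hhol : ∀ p q, IsHolomorphic fun z => κ z 0 p q) (h0 : κ 0 0 = 1) (z w : 𝔻) :
    κ z w = kernelMatrix (2 * η) Y z w := by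
  -- Moving w to 0 leaves only the first column to compare.
  rw [hinv (CoverG.toZero w) z w, kernelMatrix_invariant hY η (CoverG.toZero w) z w,
    CoverG.toZero_act_self, Complex.UnitDisc.coe_zero, kernelMatrix_zero_right hY,
    kernel_column_eq hY hinv hherm hhol h0]

end Uniqueness

/-! ### Power series on the disc. -/

section Holomorphic

/-- Extension by zero of a function on the disc. -/
def diskExtend {V : Type*} [Zero V] (f : 𝔻 → V) (z : ℂ) : V :=
  if h : ‖z‖ < 1 then f (Complex.UnitDisc.mk z h) else 0

@[simp] theorem diskExtend_coe {V : Type*} [Zero V] (f : 𝔻 → V) (z : 𝔻) : diskExtend f z = f z := by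
  rw [diskExtend, dif_pos z.norm_lt_one, Complex.UnitDisc.mk_coe]

variable {V : Type*} [NormedAddCommGroup V] [NormedSpace ℂ V]

theorem isHolomorphic_iff (f : 𝔻 → V) :
    IsHolomorphic f ↔ DifferentiableOn ℂ (diskExtend f) (Metric.ball 0 1) := by
  constructor
  · rintro ⟨F, hF, hf⟩
    refine hF.congr fun z hz => ?_
    lift z to 𝔻 using mem_ball_zero_iff.mp hz
    rw [diskExtend_coe, hf]
  · intro h
    exact ⟨_, h, fun z => (diskExtend_coe f z).symm⟩

theorem IsHolomorphic.add {f g : 𝔻 → V} (hf : IsHolomorphic f) (hg : IsHolomorphic g) :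
    IsHolomorphic (f + g) := by
  obtain ⟨F, hF, hf⟩ := hf
  obtain ⟨G, hG, hg⟩ := hg
  exact ⟨F + G, hF.add hG, fun z => by simp [hf, hg]⟩

theorem IsHolomorphic.const_smul {f : 𝔻 → V} (c : ℂ) (hf : IsHolomorphic f) :
    IsHolomorphic (c • f) := by
  obtain ⟨F, hF, hf⟩ := hf
  exact ⟨c • F, hF.const_smul c, fun z => by simp [hf]⟩

theorem IsHolomorphic.apply {ι : Type*} [Fintype ι] {f : 𝔻 → EuclideanSpace ℂ ι}
    (hf : IsHolomorphic f) (i : ι) : IsHolomorphic fun z => f z i := by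
  obtain ⟨F, hF, hf⟩ := hf
  exact ⟨fun z => F z i, differentiableOn_euclidean.mp hF i, fun z => by simp only [hf]⟩

/-- The coefficients of a power series on the disc are determined by its sum. -/
theorem powerSeries_coeff_unique {f : 𝔻 → ℂ} {a b : ℕ → ℂ}
    (ha : ∀ z : 𝔻, HasSum (fun n => a n * (z : ℂ) ^ n) (f z))
    (hb : ∀ z : 𝔻, HasSum (fun n => b n * (z : ℂ) ^ n) (f z)) : a = b := by
  have key : ∀ c : ℕ → ℂ, (∀ z : 𝔻, HasSum (fun n => c n * (z : ℂ) ^ n) (f z)) →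
      HasFPowerSeriesAt (diskExtend f) (FormalMultilinearSeries.ofScalars ℂ c) 0 := by
    intro c hc
    rw [hasFPowerSeriesAt_iff]
    filter_upwards [Metric.ball_mem_nhds (0 : ℂ) one_pos] with z hz
    lift z to 𝔻 using mem_ball_zero_iff.mp hz
    rw [zero_add, diskExtend_coe]
    refine (hc z).congr_fun fun n => ?_
    rw [FormalMultilinearSeries.coeff_ofScalars, smul_eq_mul, mul_comm]
  have h := (key a ha).eq_formalMultilinearSeries (key b hb)
  rw [FormalMultilinearSeries.ofScalars_series_eq_iff] at h
  exact h

/-- Taylor expansion with Cauchy's estimate on the circle of radius 1/2. The coefficient bound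
serves to make coefficient functionals continuous. -/
theorem IsHolomorphic.exists_hasSum {f : 𝔻 → ℂ} (hf : IsHolomorphic f) {C : ℝ}
    (hC : ∀ z : 𝔻, ‖(z : ℂ)‖ = 1 / 2 → ‖f z‖ ≤ C) :
    ∃ a : ℕ → ℂ, (∀ z : 𝔻, HasSum (fun n => a n * (z : ℂ) ^ n) (f z)) ∧
      ∀ n, ‖a n‖ ≤ C / (1 / 2) ^ n := by
  rw [isHolomorphic_iff] at hf
  refine ⟨fun n => (n.factorial : ℂ)⁻¹ * iteratedDeriv n (diskExtend f) 0, fun z => ?_, fun n => ?_⟩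
  · have h := Complex.hasSum_taylorSeries_on_ball (r := 1) hf (mem_ball_zero_iff.mpr z.norm_lt_one)
    rw [diskExtend_coe] at h
    refine h.congr_fun fun n => ?_
    simp only [sub_zero, smul_eq_mul]
    ring
  · have h := Complex.norm_iteratedDeriv_le_of_forall_mem_sphere_norm_le (c := 0) (R := 1 / 2)
      (C := C) n (by norm_num)
      ((hf.mono (Metric.closure_ball_subset_closedBall.trans
        (Metric.closedBall_subset_ball (by norm_num)))).diffContOnCl)
      (fun z hz => by
        rw [mem_sphere_zero_iff_norm] at hz
        lift z to 𝔻 using by rw [hz]; norm_num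
        rw [diskExtend_coe]
        exact hC z hz)
    rw [norm_mul, norm_inv, Complex.norm_natCast]
    have hn : (0 : ℝ) < n.factorial := by positivity
    calc (n.factorial : ℝ)⁻¹ * ‖iteratedDeriv n (diskExtend f) 0‖
        ≤ (n.factorial : ℝ)⁻¹ * (n.factorial * C / (1 / 2) ^ n) := by gcongr
      _ = C / (1 / 2) ^ n := by field_simp

end Holomorphic

/-! ### Taylor coefficients and holomorphy in reproducing kernel spaces. -/

section CoefficientFunctionals

variable {ι : Type*} [Fintype ι] {H : Type*} [NormedAddCommGroup H]
  [InnerProductSpace ℂ H] [CompleteSpace H] [RKHS ℂ H 𝔻 (EuclideanSpace ℂ ι)]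

/-- In a space of holomorphic functions with locally bounded kernel, the Taylor coefficients at
the origin are represented by elements of the space. -/
theorem exists_coeff_representer (hhol : ∀ f : H, IsHolomorphic fun z : 𝔻 => f z) {C : ℝ}
    (hC : ∀ z : 𝔻, ‖(z : ℂ)‖ ≤ 1 / 2 → ‖RKHS.kerFun H z‖ ≤ C) (n : ℕ) (q : ι) :
    ∃ g : H, ∀ (f : H) (a : ℕ → ℂ), (∀ z : 𝔻, HasSum (fun n => a n * (z : ℂ) ^ n) (f z q)) →
      inner ℂ g f = a n := by
  have hbound : ∀ (f : H) (z : 𝔻), ‖(z : ℂ)‖ = 1 / 2 → ‖f z q‖ ≤ C * ‖f‖ := by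
    intro f z hz
    calc ‖f z q‖ ≤ ‖f z‖ := PiLp.norm_apply_le (f z) q
      _ ≤ ‖f‖ * ‖RKHS.kerFun H z‖ := by
        rw [RKHS.norm_kerFun_eq_sqrt_norm_kernel]; exact RKHS.norm_apply_le f z
      _ ≤ ‖f‖ * C := mul_le_mul_of_nonneg_left (hC z hz.le) (norm_nonneg _)
      _ = C * ‖f‖ := mul_comm _ _
  choose a ha hb using fun f : H => ((hhol f).apply q).exists_hasSum (hbound f)
  let ℓ : H →ₗ[ℂ] ℂ :=
    { toFun := fun f => a f n
      map_add' := fun f g => by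
        have h := powerSeries_coeff_unique (f := fun z => (f + g) z q) (ha (f + g))
          (b := fun n => a f n + a g n) (fun z => by
            have := (ha f z).add (ha g z)
            simp only [RKHS.coe_add, Pi.add_apply, PiLp.add_apply, add_mul]
            exact this)
        exact congrFun h n
      map_smul' := fun c f => by
        have h := powerSeries_coeff_unique (f := fun z => (c • f) z q) (ha (c • f))
          (b := fun n => c * a f n) (fun z => by
            have := (ha f z).mul_left c
            simp only [RKHS.coe_smul, Pi.smul_apply, PiLp.smul_apply, smul_eq_mul, mul_assoc]
            exact this)
        exact congrFun h n }
  -- Cauchy's estimate bounds the functional, so Riesz representation applies.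
  let L : H →L[ℂ] ℂ := ℓ.mkContinuous (C / (1 / 2) ^ n) fun f => by
    refine (hb f n).trans_eq ?_
    ring
  refine ⟨(InnerProductSpace.toDual ℂ H).symm L, fun f b hfb => ?_⟩
  rw [InnerProductSpace.toDual_symm_apply]
  exact congrFun (powerSeries_coeff_unique (ha f) hfb) n

/-- If the kernel functions are holomorphic and locally bounded, then all functions in the
reproducing kernel Hilbert space are holomorphic. -/
theorem isHolomorphic_of_kerFun
    (hC : ∀ r < (1 : ℝ), ∃ C : ℝ, ∀ z : 𝔻, ‖(z : ℂ)‖ ≤ r → ‖RKHS.kerFun H z‖ ≤ C)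
    (hker : ∀ (w : 𝔻) (v : EuclideanSpace ℂ ι), IsHolomorphic fun z : 𝔻 => RKHS.kerFun H w v z)
    (f : H) : IsHolomorphic fun z : 𝔻 => f z := by
  -- The holomorphic elements form a subspace, closed because norm limits are locally uniform
  -- limits, and it contains the kernel functions, whose span is dense.
  let W : Submodule ℂ H :=
    { carrier := {f | IsHolomorphic fun z : 𝔻 => f z}
      add_mem' := fun {f g} hf hg => by
        simp only [Set.mem_ofPred_eq, RKHS.coe_add, Pi.add_apply]
        exact hf.add hg
      zero_mem' := ⟨0, differentiableOn_const 0, fun z => by simp⟩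
      smul_mem' := fun c f hf => by
        simp only [Set.mem_ofPred_eq, RKHS.coe_smul, Pi.smul_apply]
        exact hf.const_smul c }
  have hclosed : IsClosed (W : Set H) := by
    refine isClosed_of_closure_subset fun f hf => ?_
    obtain ⟨F, hFW, hFf⟩ := mem_closure_iff_seq_limit.mp hf
    change IsHolomorphic fun z : 𝔻 => f z
    rw [isHolomorphic_iff]
    refine TendstoLocallyUniformlyOn.differentiableOn (F := fun n => diskExtend fun z => F n z)
      (φ := atTop) ?_ (Eventually.of_forall fun n => (isHolomorphic_iff _).mp (hFW n))
      Metric.isOpen_ball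
    rw [tendstoLocallyUniformlyOn_iff_forall_isCompact Metric.isOpen_ball]
    intro K hK hKc
    obtain ⟨r, hr, hKr⟩ : ∃ r < (1 : ℝ), ∀ z ∈ K, ‖z‖ ≤ r := by
      rcases K.eq_empty_or_nonempty with h | h
      · exact ⟨0, one_pos, by simp [h]⟩
      · obtain ⟨z, hz, hmax⟩ := hKc.exists_isMaxOn h continuous_norm.continuousOn
        exact ⟨‖z‖, mem_ball_zero_iff.mp (hK hz), fun y hy => hmax hy⟩
    obtain ⟨C, hC⟩ := hC r hr
    have h := RKHS.tendstoUniformlyOn_of_norm_kerFun_le (s := {z : 𝔻 | ‖(z : ℂ)‖ ≤ r}) hC hFf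
    rw [Metric.tendstoUniformlyOn_iff] at h ⊢
    intro ε hε
    filter_upwards [h ε hε] with n hn z hz
    lift z to 𝔻 using mem_ball_zero_iff.mp (hK hz)
    rw [diskExtend_coe, diskExtend_coe]
    exact hn z (hKr _ hz)
  have hspan : Submodule.span ℂ {RKHS.kerFun H x v | (x : 𝔻) (v : EuclideanSpace ℂ ι)} ≤ W := by
    rw [Submodule.span_le]
    rintro _ ⟨w, v, rfl⟩
    exact hker w v
  have htop := Submodule.topologicalClosure_minimal _ hspan hclosed
  rw [RKHS.kerFun_dense] at htop
  exact htop (Submodule.mem_top (x := f))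

end CoefficientFunctionals

/-! ### Positivity and regularity of the explicit kernel. -/

section Gram

variable {m : ℕ} {d : Fin (m + 1) → ℕ} {Y : BlockMatrix d}

theorem gramMatrix_isHermitian (lam : ℝ) (Y : BlockMatrix d) (N : ℕ) :
    (gramMatrix lam Y N).IsHermitian := by
  ext p q
  rw [conjTranspose_apply, gramMatrix_apply, gramMatrix_apply, star_sum, min_comm]
  refine Finset.sum_congr rfl fun r _ => ?_
  have h1 : star ((Y ^ (q.deg - r) * levelProj r * (Y ^ (p.deg - r))ᴴ : BlockMatrix d) q p) =
      (Y ^ (p.deg - r) * levelProj r * (Y ^ (q.deg - r))ᴴ : BlockMatrix d) p q := by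
    rw [← conjTranspose_apply, conjTranspose_mul, conjTranspose_mul, conjTranspose_conjTranspose,
      levelProj_conjTranspose, Matrix.mul_assoc]
  rw [star_mul', h1, add_right_comm, add_comm q.deg, Nat.sub_right_comm, mul_comm (Nat.factorial _ : ℝ)]
  congr 1
  exact Complex.conj_ofReal _

/-- The indices of the components which occur in the homogeneous sections of degree `N`. -/
abbrev LowIndex (d : Fin (m + 1) → ℕ) (N : ℕ) : Type := {p : BlockIndex d // p.deg ≤ N}

/-- The Gram matrix of the homogeneous sections of degree `N`. -/
def lowGram (lam : ℝ) (Y : BlockMatrix d) (N : ℕ) : Matrix (LowIndex d N) (LowIndex d N) ℂ :=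
  (gramMatrix lam Y N).submatrix Subtype.val Subtype.val

theorem lowGram_apply (lam : ℝ) (Y : BlockMatrix d) (N : ℕ) (p q : LowIndex d N) :
    lowGram lam Y N p q = gramMatrix lam Y N p q := rfl

theorem gramMatrix_posDef_of_lowGram {lam : ℝ} (h : (lowGram lam Y m).PosDef) :
    (gramMatrix lam Y m).PosDef :=
  h.submatrix (e := fun p : BlockIndex d => (⟨p, p.deg_le⟩ : LowIndex d m))
    fun _ _ hpq => congrArg Subtype.val hpq

theorem gramMatrix_posSemidef (hY : IsBlockSubdiagonal Y) {lam : ℝ} (hl : 0 < lam)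
    (h : (fullGram lam Y).PosDef) (N : ℕ) : (gramMatrix lam Y N).PosSemidef := by
  have h1 := ((posDef_middle_iff hY hl N).mpr h).posSemidef.mul_mul_conjTranspose_same
    (truncation N)
  rwa [truncation_conjTranspose, ← gramMatrix_eq hY hl N] at h1

/-- Restricted to components of index at most N, the truncation factor is invertible, so
definiteness survives; on the full index set only semidefiniteness does. -/
theorem lowGram_posDef (hY : IsBlockSubdiagonal Y) {lam : ℝ} (hl : 0 < lam)
    (h : (fullGram lam Y).PosDef) (N : ℕ) : (lowGram lam Y N).PosDef := by
  set E : Matrix (LowIndex d N) (LowIndex d N) ℂ :=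
    diagonal fun p => ((1 / (N - p.1.deg).factorial : ℝ) : ℂ) with hE
  have hU : IsUnit E := by
    rw [isUnit_iff_isUnit_det, det_diagonal, isUnit_iff_ne_zero, Finset.prod_ne_zero_iff]
    intro s _
    exact Complex.ofReal_ne_zero.mpr (by positivity)
  have hstar : star E = E := by
    rw [star_eq_conjTranspose, hE, diagonal_conjTranspose]
    congr 1; funext s; simp
  have h1 := ((posDef_middle_iff hY hl N).mpr h).submatrix
    (Subtype.val_injective (p := fun p : BlockIndex d => p.deg ≤ N))
  have h2 : lowGram lam Y N = E * (intertwinerMatrix lam Y * scaledGram lam Y N *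
      (intertwinerMatrix lam Y)ᴴ).submatrix Subtype.val Subtype.val * star E := by
    ext p q
    rw [hstar, hE, mul_diagonal, diagonal_mul, lowGram_apply, gramMatrix_eq hY hl, truncation,
      mul_diagonal, diagonal_mul, if_pos p.2, if_pos q.2]
    rfl
  rw [h2, IsUnit.posDef_star_right_conjugate_iff hU]
  exact h1

/-- The kernel as an operator valued matrix. -/
def diskKernel (lam : ℝ) (Y : BlockMatrix d) : Matrix 𝔻 𝔻 (Fiber d →L[ℂ] Fiber d) :=
  of fun z w => toEuclideanCLM (𝕜 := ℂ) (kernelMatrix lam Y z w)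

theorem adjoint_toEuclideanCLM (A : BlockMatrix d) :
    ContinuousLinearMap.adjoint (toEuclideanCLM (𝕜 := ℂ) A) = toEuclideanCLM (𝕜 := ℂ) Aᴴ :=
  (map_star (toEuclideanCLM (𝕜 := ℂ)) A).symm

theorem diskKernel_apply_apply (lam : ℝ) (Y : BlockMatrix d) (z w : 𝔻) (v : Fiber d)
    (p : BlockIndex d) : diskKernel lam Y z w v p = ∑ q, kernelMatrix lam Y z w p q * v q := rfl

theorem diskKernel_isHermitian (lam : ℝ) (Y : BlockMatrix d) : (diskKernel lam Y).IsHermitian := by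
  ext1 z w
  rw [conjTranspose_apply, ContinuousLinearMap.star_eq_adjoint]
  simp only [diskKernel, of_apply]
  rw [adjoint_toEuclideanCLM, kernelMatrix_conjTranspose]

/-- The quadratic form of the kernel is a convergent sum over N of the quadratic forms of the Gram
matrices. -/
theorem diskKernel_posSemidef {lam : ℝ} (h : ∀ N, (gramMatrix lam Y N).PosSemidef) :
    (diskKernel lam Y).PosSemidef := by
  have htfae := (RKHS.posSemidef_tfae (K := diskKernel lam Y)).out 0 2
  refine htfae.mpr ⟨diskKernel_isHermitian lam Y, fun vv => ?_⟩
  have hterm : ∀ (x x' : 𝔻) (w w' : Fiber d),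
      HasSum (fun N => ∑ p, ∑ q, (w' p * (conj (gramMatrix lam Y N p q) *
        (conj (x' : ℂ) ^ (N - p.deg) * (x : ℂ) ^ (N - q.deg))) * conj (w q)))
        (inner ℂ (diskKernel lam Y x' x w) w') := by
    intro x x' w w'
    have h1 : inner ℂ (diskKernel lam Y x' x w) w' =
        ∑ p, ∑ q, w' p * conj (kernelMatrix lam Y x' x p q) * conj (w q) := by
      rw [PiLp.inner_apply]
      refine Finset.sum_congr rfl fun p _ => ?_
      rw [diskKernel_apply_apply, RCLike.inner_apply, map_sum, Finset.mul_sum]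
      refine Finset.sum_congr rfl fun q _ => ?_
      rw [map_mul]; ring
    rw [h1]
    refine hasSum_sum fun p _ => hasSum_sum fun q _ => ?_
    have h2 := ((Complex.hasSum_conj'.mpr (hasSum_kernelMatrix lam Y x' x p q)).mul_left
      (w' p)).mul_right (conj (w q))
    refine h2.congr_fun fun N => ?_
    simp only [map_mul, map_pow, Complex.conj_conj]
    ring
  -- The vector on which the N-th Gram matrix is evaluated, gathering all sample points.
  set u : ℕ → BlockIndex d → ℂ := fun N q => ∑ x ∈ vv.support, conj (x : ℂ) ^ (N - q.deg) * vv x q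
    with hu
  have hsum : HasSum (fun N => conj (star (u N) ⬝ᵥ (gramMatrix lam Y N *ᵥ u N)))
      (vv.sum fun x w => vv.sum fun x' w' => inner ℂ (diskKernel lam Y x' x w) w') := by
    refine (hasSum_sum fun x _ => hasSum_sum fun x' _ => hterm x x' (vv x) (vv x')).congr_fun
      fun N => ?_
    have e1 : conj (star (u N) ⬝ᵥ (gramMatrix lam Y N *ᵥ u N)) =
        ∑ p, ∑ q, u N p * conj (gramMatrix lam Y N p q) * conj (u N q) := by
      simp only [dotProduct, mulVec, map_sum, map_mul, Pi.star_apply, Finset.mul_sum,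
        RCLike.star_def, Complex.conj_conj, mul_assoc]
    have e2 : ∀ p q, u N p * conj (gramMatrix lam Y N p q) * conj (u N q) =
        ∑ x ∈ vv.support, ∑ x' ∈ vv.support, (vv x' p * (conj (gramMatrix lam Y N p q) *
        (conj (x' : ℂ) ^ (N - p.deg) * (x : ℂ) ^ (N - q.deg))) * conj (vv x q)) := by
      intro p q
      rw [hu, map_sum, Finset.sum_mul, Finset.sum_mul_sum, Finset.sum_comm]
      refine Finset.sum_congr rfl fun x _ => Finset.sum_congr rfl fun x' _ => ?_
      simp only [map_mul, map_pow, Complex.conj_conj]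
      ring
    rw [e1]
    simp_rw [e2]
    rw [Finset.sum_congr rfl fun p _ => Finset.sum_comm, Finset.sum_comm]
    refine Finset.sum_congr rfl fun x _ => ?_
    rw [Finset.sum_congr rfl fun p _ => Finset.sum_comm, Finset.sum_comm]
  have hre := Complex.hasSum_re hsum
  refine hre.nonneg fun N => ?_
  rw [Complex.conj_re]
  exact (Complex.nonneg_iff.mp ((h N).dotProduct_mulVec_nonneg (u N))).1

theorem continuous_kernelMatrix_diag (lam : ℝ) (Y : BlockMatrix d) :
    Continuous fun z : 𝔻 => kernelMatrix lam Y z z := by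
  refine continuous_matrix fun p q => ?_
  simp_rw [kernelMatrix_apply]
  have h1 : Continuous fun z : 𝔻 => (z : ℂ) := Complex.UnitDisc.continuous_coe
  have h2 : Continuous fun z : 𝔻 => Complex.log (1 - z * conj (z : ℂ)) :=
    Continuous.clog (by fun_prop) fun z => one_sub_mul_conj_mem_slitPlane z z
  fun_prop

theorem exists_norm_diskKernel_le (lam : ℝ) (Y : BlockMatrix d) {r : ℝ} (hr : r < 1) :
    ∃ C : ℝ, ∀ z : 𝔻, ‖(z : ℂ)‖ ≤ r → ‖diskKernel lam Y z z‖ ≤ C := by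
  have hcont : Continuous fun z : 𝔻 => ‖diskKernel lam Y z z‖ := by
    have h1 : Continuous (toEuclideanCLM (n := BlockIndex d) (𝕜 := ℂ)) :=
      (toEuclideanCLM (n := BlockIndex d) (𝕜 := ℂ)).toAlgEquiv.toLinearMap.continuous_of_finiteDimensional
    exact (h1.comp (continuous_kernelMatrix_diag lam Y)).norm
  have hcomp : IsCompact {z : 𝔻 | ‖(z : ℂ)‖ ≤ r} := by
    have h2 : {z : 𝔻 | ‖(z : ℂ)‖ ≤ r} = (fun z : 𝔻 => (z : ℂ)) ⁻¹' Metric.closedBall 0 r := by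
      ext z; simp
    rw [h2, Complex.UnitDisc.isEmbedding_coe.isInducing.isCompact_preimage_iff]
    · exact isCompact_closedBall 0 r
    · intro z hz
      exact ⟨Complex.UnitDisc.mk z ((mem_closedBall_zero_iff.mp hz).trans_lt hr), rfl⟩
  obtain ⟨C, hC⟩ := hcomp.bddAbove_image hcont.continuousOn
  exact ⟨C, fun z hz => hC ⟨z, hz, rfl⟩⟩

theorem isHolomorphic_diskKernel (lam : ℝ) (Y : BlockMatrix d) (w : 𝔻) (v : Fiber d) :
    IsHolomorphic fun z => diskKernel lam Y z w v := by
  refine ⟨fun z => WithLp.toLp 2 fun p => ∑ q, (∑ r ∈ Finset.range (min p.deg q.deg + 1),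
      Complex.exp (-(lam + p.deg + q.deg : ℝ) * Complex.log (1 - z * conj (w : ℂ))) *
      (conj (w : ℂ) ^ (p.deg - r) / (p.deg - r).factorial *
        (z ^ (q.deg - r) / (q.deg - r).factorial) *
      (Y ^ (p.deg - r) * levelProj r * (Y ^ (q.deg - r))ᴴ : BlockMatrix d) p q)) * v q, ?_, ?_⟩
  · rw [differentiableOn_euclidean]
    intro p
    simp only
    have hlog : DifferentiableOn ℂ (fun z => Complex.log (1 - z * conj (w : ℂ)))
        (Metric.ball 0 1) := by
      refine DifferentiableOn.clog (by fun_prop) fun z hz => ?_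
      lift z to 𝔻 using mem_ball_zero_iff.mp hz
      exact one_sub_mul_conj_mem_slitPlane z w
    refine DifferentiableOn.fun_sum fun q _ => DifferentiableOn.mul_const
      (DifferentiableOn.fun_sum fun r _ => ?_) _
    refine DifferentiableOn.mul (hlog.const_mul _).cexp ?_
    fun_prop
  · intro z
    ext p
    rw [diskKernel_apply_apply]
    simp_rw [kernelMatrix_apply]

end Gram

/-! ### From reproducing spaces to the admissibility condition and back. -/

section Reproducing

variable {m : ℕ} {d : Fin (m + 1) → ℕ} {Y : BlockMatrix d}
  {H : Type} [NormedAddCommGroup H] [InnerProductSpace ℂ H]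
  [RKHS ℂ H 𝔻 (Fiber d)]

theorem rkhs_sum_apply {ι : Type*} (s : Finset ι) (f : ι → H) (z : 𝔻) :
    (∑ i ∈ s, f i) z = ∑ i ∈ s, f i z := by
  simp [← RKHS.coeCLM_apply, map_sum]

variable [CompleteSpace H]

theorem exists_norm_kerFun_le {lam : ℝ} (hK : RKHS.kernel H = diskKernel lam Y) {r : ℝ}
    (hr : r < 1) : ∃ C : ℝ, ∀ z : 𝔻, ‖(z : ℂ)‖ ≤ r → ‖RKHS.kerFun H z‖ ≤ C := by
  obtain ⟨C, hC⟩ := exists_norm_diskKernel_le lam Y hr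
  refine ⟨√C, fun z hz => ?_⟩
  rw [RKHS.norm_kerFun_eq_sqrt_norm_kernel, hK]
  exact Real.sqrt_le_sqrt (hC z hz)

theorem isHolomorphic_of_kernel_eq {lam : ℝ} (hK : RKHS.kernel H = diskKernel lam Y) (f : H) :
    IsHolomorphic fun z : 𝔻 => f z := by
  refine isHolomorphic_of_kerFun (fun r hr => exists_norm_kerFun_le hK hr) (fun w v => ?_) f
  simp_rw [RKHS.kerFun_apply, hK]
  exact isHolomorphic_diskKernel lam Y w v

/-- The homogeneous sections `∑ p, A_N(p, q) z ^ (N - p)` belong to the space and represent Taylor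
coefficients. -/
theorem exists_homogeneous_section {lam : ℝ} (hK : RKHS.kernel H = diskKernel lam Y) (N : ℕ)
    (q : LowIndex d N) : ∃ g : H,
      (∀ (z : 𝔻) (p : BlockIndex d), g z p = gramMatrix lam Y N p q * (z : ℂ) ^ (N - p.deg)) ∧
      ∀ (f : H) (a : ℕ → ℂ), (∀ z : 𝔻, HasSum (fun n => a n * (z : ℂ) ^ n) (f z q)) →
        inner ℂ g f = a (N - q.1.deg) := by
  obtain ⟨C, hC⟩ := exists_norm_kerFun_le hK (r := 1 / 2) (by norm_num)
  obtain ⟨g, hg⟩ := exists_coeff_representer (isHolomorphic_of_kernel_eq hK) hC (N - q.1.deg) q.1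
  refine ⟨g, fun z p => ?_, hg⟩
  -- Pairing the representer with a kernel function evaluates it at z, while the expansion of the
  -- kernel gives the same pairing as a Taylor coefficient.
  have h1 := hg (RKHS.kerFun H z (EuclideanSpace.single p 1))
    (fun n => gramMatrix lam Y (n + q.1.deg) q p * conj (z : ℂ) ^ (n + q.1.deg - p.deg))
    (fun x => by
      have h2 := hasSum_kernelMatrix lam Y x z q p
      have hinj : Function.Injective fun n : ℕ => n + q.1.deg := add_left_injective _
      rw [← hinj.hasSum_iff] at h2
      · have h3 : RKHS.kerFun H z (EuclideanSpace.single p (1 : ℂ)) x q.1 =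
            kernelMatrix lam Y x z q p := by
          rw [RKHS.kerFun_apply, hK, diskKernel_apply_apply]
          simp
        rw [h3]
        refine h2.congr_fun fun n => ?_
        simp only [Function.comp_apply, Nat.add_sub_cancel]
        ring
      · intro n hn
        rw [gramMatrix_apply_eq_zero]
        · simp
        · left
          by_contra hlt
          exact hn ⟨n - q.1.deg, Nat.sub_add_cancel (not_lt.mp hlt)⟩)
  rw [RKHS.inner_kerFun, EuclideanSpace.inner_single_right, one_mul, Nat.sub_add_cancel q.2] at h1
  rw [← Complex.conj_conj (g z p), h1, map_mul, map_pow, Complex.conj_conj,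
    ← (gramMatrix_isHermitian lam Y N).apply p q]
  rfl

theorem hasSum_monomial (c : ℂ) (k : ℕ) (z : 𝔻) :
    HasSum (fun n => (if n = k then c else 0) * (z : ℂ) ^ n) (c * (z : ℂ) ^ k) := by
  have h := hasSum_single (f := fun n => (if n = k then c else 0) * (z : ℂ) ^ n) k
    (fun n hn => by simp [hn])
  simpa using h

/-- The entries are inner products of the homogeneous sections. These are linearly independent
because the monomials z^(N - q) e_q, which lie in the space, are dual to them. -/
theorem lowGram_posDef_of_polynomial {lam : ℝ} (hK : RKHS.kernel H = diskKernel lam Y)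
    (hpoly : ∀ (k : ℕ) (v : Fiber d), ∃ f : H, ∀ z : 𝔻, f z = (z : ℂ) ^ k • v) (N : ℕ) :
    (lowGram lam Y N).PosDef := by
  choose g hg hrep using fun q : LowIndex d N => exists_homogeneous_section hK N q
  have hinner : ∀ p q, inner ℂ (g p) (g q) = lowGram lam Y N p q := by
    intro p q
    rw [hrep p (g q) (fun n => if n = N - p.1.deg then gramMatrix lam Y N p q else 0)
      (fun z => by rw [hg]; exact hasSum_monomial _ _ z), if_pos rfl, lowGram_apply]
  refine PosDef.of_dotProduct_mulVec_pos
    ((gramMatrix_isHermitian lam Y N).submatrix Subtype.val) fun u hu => ?_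
  have h1 : star u ⬝ᵥ (lowGram lam Y N *ᵥ u) = inner ℂ (∑ p, u p • g p) (∑ q, u q • g q) := by
    rw [sum_inner]
    simp_rw [inner_sum, inner_smul_left, inner_smul_right, hinner]
    simp only [dotProduct, mulVec, Pi.star_apply, Finset.mul_sum, RCLike.star_def]
    refine Finset.sum_congr rfl fun p _ => Finset.sum_congr rfl fun q _ => ?_
    ring
  change 0 < star u ⬝ᵥ (lowGram lam Y N *ᵥ u)
  rw [h1, inner_self_eq_norm_sq_to_K]
  have h2 : ∑ p, u p • g p ≠ 0 := by
    intro h0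
    apply hu
    funext q
    obtain ⟨f, hf⟩ := hpoly (N - q.1.deg) (EuclideanSpace.single q.1 1)
    have h3 : ∀ p, inner ℂ (g p) f = if p = q then 1 else 0 := by
      intro p
      rw [hrep p f (fun n => if n = N - q.1.deg then (if p = q then 1 else 0) else 0) (fun z => by
        have h4 : f z p.1 = (if p = q then 1 else 0) * (z : ℂ) ^ (N - q.1.deg) := by
          rw [hf]
          simp [Subtype.ext_iff, mul_comm]
        rw [h4]
        exact hasSum_monomial _ _ z)]
      by_cases hpq : p = q
      · rw [hpq]; simp
      · simp [hpq]
    have h5 : inner ℂ (∑ p, u p • g p) f = 0 := by rw [h0, inner_zero_left]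
    rw [sum_inner] at h5
    simp_rw [inner_smul_left, h3] at h5
    simpa using h5
  have h6 : 0 < ‖∑ p, u p • g p‖ := norm_pos_iff.mpr h2
  have h7 : (0 : ℂ) < ((‖∑ p, u p • g p‖ ^ 2 : ℝ) : ℂ) := by
    exact_mod_cast (by positivity : 0 < ‖∑ p, u p • g p‖ ^ 2)
  simpa using h7

/-- Inverting the Gram matrix of degree N = k + q writes z^k e_q as a combination of homogeneous
sections. -/
theorem polynomial_mem_of_lowGram {lam : ℝ} (hK : RKHS.kernel H = diskKernel lam Y)
    (hpos : ∀ N, (lowGram lam Y N).PosDef) (k : ℕ) (v : Fiber d) :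
    ∃ f : H, ∀ z : 𝔻, f z = (z : ℂ) ^ k • v := by
  have hbasis : ∀ q : BlockIndex d, ∃ f : H, ∀ (z : 𝔻) (p : BlockIndex d),
      f z p = if p = q then (z : ℂ) ^ k else 0 := by
    intro q
    set N := k + q.deg with hN
    choose g hg hrep using fun q : LowIndex d N => exists_homogeneous_section hK N q
    have hunit := (isUnit_iff_isUnit_det _).mp (hpos N).isUnit
    set x : LowIndex d N → ℂ := fun r => (lowGram lam Y N)⁻¹ r ⟨q, by omega⟩ with hx
    have hmul : ∀ p : LowIndex d N, ∑ r, lowGram lam Y N p r * x r =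
        (1 : Matrix (LowIndex d N) (LowIndex d N) ℂ) p ⟨q, by omega⟩ := by
      intro p
      rw [← Matrix.mul_nonsing_inv _ hunit, mul_apply]
    refine ⟨∑ r, x r • g r, fun z p => ?_⟩
    rw [rkhs_sum_apply]
    have h1 : (∑ r, (x r • g r) z) p = (∑ r : LowIndex d N, gramMatrix lam Y N p r * x r) *
        (z : ℂ) ^ (N - p.deg) := by
      rw [WithLp.ofLp_sum, Finset.sum_apply, Finset.sum_mul]
      refine Finset.sum_congr rfl fun r _ => ?_
      rw [RKHS.coe_smul, Pi.smul_apply, PiLp.smul_apply, hg, smul_eq_mul]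
      ring
    rw [h1]
    by_cases hp : p.deg ≤ N
    · have h2 := hmul ⟨p, hp⟩
      simp only [lowGram_apply] at h2
      rw [h2]
      simp only [one_apply, Subtype.mk.injEq]
      split_ifs with hpq
      · rw [hpq, hN, Nat.add_sub_cancel, one_mul]
      · rw [zero_mul]
    · rw [if_neg (by rintro rfl; omega), Finset.sum_eq_zero, zero_mul]
      intro r _
      rw [gramMatrix_apply_eq_zero _ _ (by omega), zero_mul]
  choose f hf using hbasis
  refine ⟨∑ q, v q • f q, fun z => ?_⟩
  ext p
  rw [rkhs_sum_apply, WithLp.ofLp_sum, Finset.sum_apply]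
  simp_rw [RKHS.coe_smul, Pi.smul_apply, PiLp.smul_apply, hf]
  simp [mul_comm]

theorem kernel_eq_diskKernel (hY : IsBlockSubdiagonal Y) {η : ℝ} (hH : IsReproducingSpace η Y H) :
    RKHS.kernel H = diskKernel (2 * η) Y := by
  set Φ := toEuclideanCLM (n := BlockIndex d) (𝕜 := ℂ) with hΦ
  have hΦinj : Function.Injective Φ := EquivLike.injective Φ
  set κ : 𝔻 → 𝔻 → BlockMatrix d := fun z w => Φ.symm (RKHS.kernel H z w) with hκ
  have hκΦ : ∀ z w, Φ (κ z w) = RKHS.kernel H z w := fun z w => Φ.apply_symm_apply _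
  ext1 z w
  rw [← hκΦ]
  simp only [diskKernel, of_apply]
  congr 1
  refine kernel_eq_kernelMatrix hY (fun g z w => ?_) (fun z w => ?_) (fun p q => ?_) ?_ z w
  · apply hΦinj
    rw [map_mul, map_mul, hκΦ, hκΦ, hH.kernel_invariant g z w, multiplierCLM, multiplierCLM,
      adjoint_toEuclideanCLM]
    rfl
  · apply hΦinj
    rw [hκΦ, ← (RKHS.isHermitian_kernel H).apply w z, ← hκΦ z w,
      ContinuousLinearMap.star_eq_adjoint, hΦ, adjoint_toEuclideanCLM]
  · have h1 := (hH.holomorphic (RKHS.kerFun H 0 (EuclideanSpace.single q 1))).apply p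
    have h2 : ∀ z, RKHS.kerFun H 0 (EuclideanSpace.single q (1 : ℂ)) z p = κ z 0 p q := by
      intro z
      rw [RKHS.kerFun_apply, ← hκΦ]
      change (κ z 0 *ᵥ (EuclideanSpace.single q (1 : ℂ)).ofLp) p = _
      simp
    simpa only [h2] using h1
  · apply hΦinj
    rw [hκΦ, hH.kernel_zero, map_one]
    rfl

/-- The condition on `λ = 2 η` and `Y` which characterizes the bundles with reproducing kernel. -/
def IsAdmissible (lam : ℝ) (Y : BlockMatrix d) : Prop := 0 < lam ∧ (fullGram lam Y).PosDef

theorem IsReproducingSpace.isAdmissible (hd : ∀ j, 0 < d j) (hY : IsBlockSubdiagonal Y) {η : ℝ}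
    (hH : IsReproducingSpace η Y H) : IsAdmissible (2 * η) Y := by
  have hK := kernel_eq_diskKernel hY hH
  have hpos := lowGram_posDef_of_polynomial hK hH.polynomial_mem
  have hl : 0 < 2 * η := by
    let p : BlockIndex d := ⟨0, ⟨0, hd 0⟩⟩
    have hp : p.deg = 0 := rfl
    -- In degree N = 1 the diagonal entry at an index of degree 0 is λ itself.
    have h1 := (hpos 1).diag_pos (i := ⟨p, by omega⟩)
    have h2 : lowGram (2 * η) Y 1 ⟨p, by omega⟩ ⟨p, by omega⟩ = ((2 * η : ℝ) : ℂ) := by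
      rw [lowGram_apply, gramMatrix_apply]
      simp only [hp]
      simp [levelProj, hp, binom, rising]
    rw [h2] at h1
    exact_mod_cast h1
  exact ⟨hl, (posDef_fullGram_iff hY hl).mpr (gramMatrix_posDef_of_lowGram (hpos m))⟩

theorem hasReproducingKernel_of_isAdmissible (hY : IsBlockSubdiagonal Y) {η : ℝ}
    (h : IsAdmissible (2 * η) Y) : HasReproducingKernel η Y := by
  obtain ⟨hl, hM⟩ := h
  have : Fact (diskKernel (2 * η) Y).PosSemidef :=
    ⟨diskKernel_posSemidef fun N => gramMatrix_posSemidef hY hl hM N⟩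
  have hK : RKHS.kernel (RKHS.OfKernel (diskKernel (2 * η) Y)) = diskKernel (2 * η) Y :=
    RKHS.OfKernel.kernel_ofKernel
  refine ⟨RKHS.OfKernel (diskKernel (2 * η) Y), inferInstance, inferInstance, inferInstance,
    inferInstance, ?_⟩
  refine ⟨isHolomorphic_of_kernel_eq hK,
    polynomial_mem_of_lowGram hK (fun N => lowGram_posDef hY hl hM N), fun g z w => ?_, ?_⟩
  · rw [hK]
    simp only [diskKernel, of_apply, multiplierCLM]
    rw [kernelMatrix_invariant hY η g z w, adjoint_toEuclideanCLM, map_mul, map_mul]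
    rfl
  · rw [hK]
    simp only [diskKernel, of_apply, Complex.UnitDisc.coe_zero]
    rw [kernelMatrix_zero_right hY, map_zero, expY_zero hY, conjTranspose_one, map_one]
    rfl

theorem hasReproducingKernel_iff (hd : ∀ j, 0 < d j) (hY : IsBlockSubdiagonal Y) (η : ℝ) :
    HasReproducingKernel η Y ↔ IsAdmissible (2 * η) Y := by
  refine ⟨?_, hasReproducingKernel_of_isAdmissible hY⟩
  rintro ⟨H, _, _, _, _, hH⟩
  exact hH.isAdmissible hd hY

end Reproducing

/-- Positive definiteness is an open condition on Hermitian matrices. -/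
theorem eventually_posDef_of_tendsto {α ι : Type*} [Fintype ι] {l : Filter α}
    {F : α → Matrix ι ι ℂ} {A : Matrix ι ι ℂ} (hF : Tendsto F l (𝓝 A)) (hA : A.PosDef)
    (hherm : ∀ a, (F a).IsHermitian) : ∀ᶠ a in l, (F a).PosDef := by
  have hcont : Continuous fun z : Matrix ι ι ℂ × (ι → ℂ) => (star z.2 ⬝ᵥ (z.1 *ᵥ z.2)).re := by
    refine Complex.continuous_re.comp (Continuous.dotProduct (by fun_prop) ?_)
    exact Continuous.matrix_mulVec continuous_fst continuous_snd
  -- Compactness of the unit sphere makes positivity uniform in the vector; homogeneity then extends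
  -- it to all nonzero vectors.
  have h1 : ∀ᶠ B in 𝓝 A, ∀ x ∈ Metric.sphere (0 : ι → ℂ) 1, 0 < (star x ⬝ᵥ (B *ᵥ x)).re := by
    refine (isCompact_sphere (0 : ι → ℂ) 1).eventually_forall_of_forall_eventually fun x hx => ?_
    refine (hcont.tendsto (A, x)).eventually (lt_mem_nhds ?_)
    have hx0 : x ≠ 0 := by
      rintro rfl
      simp at hx
    exact (Complex.pos_iff.mp (hA.dotProduct_mulVec_pos hx0)).1
  filter_upwards [hF.eventually h1] with a ha
  refine PosDef.of_dotProduct_mulVec_pos (hherm a) fun x hx => ?_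
  have hn : ‖x‖ ≠ 0 := norm_ne_zero_iff.mpr hx
  have h2 := ha ((‖x‖⁻¹ : ℂ) • x) (by
    rw [mem_sphere_zero_iff_norm, norm_smul]
    simp [hn])
  have h3 : star ((‖x‖⁻¹ : ℂ) • x) ⬝ᵥ (F a *ᵥ ((‖x‖⁻¹ : ℂ) • x)) =
      ((‖x‖⁻¹ * ‖x‖⁻¹ : ℝ) : ℂ) * (star x ⬝ᵥ (F a *ᵥ x)) := by
    rw [star_smul, mulVec_smul, smul_dotProduct, dotProduct_smul, smul_smul, smul_eq_mul]
    simp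
  rw [h3, Complex.re_ofReal_mul] at h2
  have h4 : 0 < ‖x‖⁻¹ * ‖x‖⁻¹ := by positivity
  rw [Complex.pos_iff]
  exact ⟨pos_of_mul_pos_right h2 h4.le, ((hherm a).im_star_dotProduct_mulVec_self x).symm⟩

/-! ### Dependence of admissibility on λ. -/

section Threshold

variable {m : ℕ} {d : Fin (m + 1) → ℕ} {Y : BlockMatrix d}

theorem fullGram_isHermitian (hY : IsBlockSubdiagonal Y) (lam : ℝ) :
    (fullGram lam Y).IsHermitian := by
  ext s t
  rw [conjTranspose_apply]
  simp only [fullGram, of_apply]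
  rw [(levelGram_isHermitian lam Y t.deg).apply s t]
  by_cases h : s.deg = t.deg
  · rw [h]
  · rw [levelGram_apply_eq_zero hY _ _ _ _ (by omega), levelGram_apply_eq_zero hY _ _ _ _ (by omega)]

theorem continuous_rising (n : ℕ) : Continuous fun x : ℝ => rising x n :=
  continuous_finsetProd _ fun i _ => by fun_prop

theorem continuousAt_intertwiner {lam : ℝ} (hl : 0 < lam) (i k : ℕ) :
    ContinuousAt (fun x => intertwiner x i k) lam := by
  have h1 : Continuous fun x : ℝ => (k.factorial : ℝ) * rising (x + 2 * i) k :=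
    continuous_const.mul ((continuous_rising k).comp (by fun_prop))
  refine ContinuousAt.div continuousAt_const h1.continuousAt ?_
  exact (mul_pos (by positivity) (rising_pos (by positivity) k)).ne'

theorem continuousAt_levelGram {lam : ℝ} (hl : 0 < lam) (Y : BlockMatrix d) (n : ℕ) :
    ContinuousAt (fun x => levelGram x Y n) lam := by
  induction n using Nat.strong_induction_on with
  | _ n ih =>
    simp_rw [fun x => levelGram_eq x Y n]
    refine continuousAt_const.sub (tendsto_finsetSum _ fun i hi => ?_)
    have h1 := Complex.continuous_ofReal.continuousAt.comp
      (continuousAt_intertwiner hl i (n - i))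
    exact h1.smul ((continuousAt_const.mul (ih i (Finset.mem_range.mp hi))).mul continuousAt_const)

theorem one_le_rising {x : ℝ} (hx : 1 ≤ x) (n : ℕ) : 1 ≤ rising x n := by
  induction n with
  | zero => simp
  | succ n ih =>
    rw [rising_succ]
    exact one_le_mul_of_one_le_of_one_le ih (le_add_of_le_of_nonneg hx n.cast_nonneg)

/-- For x > 0 the constant is at most 1/x, since every other factor of the denominator is at least
1. -/
theorem tendsto_intertwiner (i : ℕ) {k : ℕ} (hk : 0 < k) :
    Tendsto (fun x => intertwiner x i k) atTop (𝓝 0) := by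
  refine squeeze_zero' ?_ ?_ (tendsto_inv_atTop_zero (𝕜 := ℝ))
  · filter_upwards [eventually_gt_atTop 0] with x hx
    have := rising_pos (x := x + 2 * i) (by positivity) k
    unfold intertwiner
    positivity
  · filter_upwards [eventually_gt_atTop 0] with x hx
    obtain ⟨j, rfl⟩ := Nat.exists_eq_add_of_le hk
    rw [intertwiner, one_div]
    refine inv_anti₀ hx ?_
    have h1 : rising (x + 2 * i) (1 + j) = (x + 2 * i) * rising (x + 2 * i + 1) j := by
      rw [rising_add]; simp [rising]
    have h2 : 1 ≤ rising (x + 2 * i + 1) j := by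
      refine one_le_rising ?_ j
      have : 0 < x + 2 * i := by positivity
      linarith
    have h3 : (1 : ℝ) ≤ ((1 + j).factorial : ℝ) := by exact_mod_cast Nat.factorial_pos _
    have h4 : x ≤ x + 2 * i := by
      have : (0 : ℝ) ≤ i := i.cast_nonneg
      linarith
    calc x ≤ (x + 2 * i) * rising (x + 2 * i + 1) j := by nlinarith
      _ = rising (x + 2 * i) (1 + j) := h1.symm
      _ ≤ _ := le_mul_of_one_le_left (rising_pos (by positivity) _).le h3

theorem tendsto_levelGram (Y : BlockMatrix d) (n : ℕ) :
    Tendsto (fun x => levelGram x Y n) atTop (𝓝 (levelProj n)) := by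
  induction n using Nat.strong_induction_on with
  | _ n ih =>
    have h1 : Tendsto (fun x => levelProj n - ∑ i ∈ Finset.range n,
        (intertwiner x i (n - i) : ℂ) • (Y ^ (n - i) * levelGram x Y i * (Y ^ (n - i))ᴴ)) atTop
        (𝓝 (levelProj n - ∑ i ∈ Finset.range n,
          ((0 : ℝ) : ℂ) • (Y ^ (n - i) * levelProj i * (Y ^ (n - i))ᴴ))) := by
      refine tendsto_const_nhds.sub (tendsto_finsetSum _ fun i hi => ?_)
      have hi' := Finset.mem_range.mp hi
      have h2 := (Complex.continuous_ofReal.tendsto 0).comp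
        (tendsto_intertwiner i (k := n - i) (by omega))
      exact h2.smul ((tendsto_const_nhds.mul (ih i hi')).mul tendsto_const_nhds)
    simp_rw [← levelGram_eq] at h1
    simpa using h1

theorem tendsto_fullGram (Y : BlockMatrix d) :
    Tendsto (fun x => fullGram x Y) atTop (𝓝 1) := by
  refine tendsto_pi_nhds.mpr fun s => tendsto_pi_nhds.mpr fun t => ?_
  rw [one_apply_eq_levelProj]
  exact tendsto_pi_nhds.mp (tendsto_pi_nhds.mp (tendsto_levelGram Y s.deg) s) t

theorem continuousAt_fullGram {lam : ℝ} (hl : 0 < lam) (Y : BlockMatrix d) :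
    ContinuousAt (fun x => fullGram x Y) lam := by
  refine tendsto_pi_nhds.mpr fun s => tendsto_pi_nhds.mpr fun t => ?_
  exact tendsto_pi_nhds.mp (tendsto_pi_nhds.mp (continuousAt_levelGram hl Y s.deg) s) t

theorem IsAdmissible.eventually (hY : IsBlockSubdiagonal Y) {lam : ℝ} (h : IsAdmissible lam Y) :
    ∀ᶠ x in 𝓝 lam, IsAdmissible x Y :=
  (lt_mem_nhds h.1).and (eventually_posDef_of_tendsto (continuousAt_fullGram h.1 Y) h.2
    fun x => fullGram_isHermitian hY x)

theorem eventually_isAdmissible (hY : IsBlockSubdiagonal Y) :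
    ∀ᶠ x in atTop, IsAdmissible x Y :=
  (eventually_gt_atTop 0).and (eventually_posDef_of_tendsto (tendsto_fullGram Y) PosDef.one
    fun x => fullGram_isHermitian hY x)

/-- Tensoring with a line bundle multiplies the kernel by a power of `(1 - z w̄)⁻¹`. -/
theorem gramMatrix_add (lam ε : ℝ) (Y : BlockMatrix d) (N : ℕ) : gramMatrix (lam + ε) Y N =
    ∑ k ∈ Finset.range (N + 1), (binom ε k : ℂ) • gramMatrix lam Y (N - k) := by
  ext p q
  rw [Matrix.sum_apply]
  simp_rw [Matrix.smul_apply, gramMatrix_apply, smul_eq_mul, Finset.mul_sum]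
  rw [Finset.sum_comm]
  refine Finset.sum_congr rfl fun r hr => ?_
  have hr' : r ≤ p.deg ∧ r ≤ q.deg := by simp at hr; omega
  simp_rw [← mul_assoc]
  rw [← Finset.sum_mul]
  congr 1
  -- The powers of (1 - z w̄)⁻¹ multiply, so their coefficients convolve.
  rw [show lam + ε + p.deg + q.deg = ε + (lam + p.deg + q.deg) by ring, binom_add]
  split_ifs with h
  · rw [Finset.sum_div]
    push_cast
    refine Finset.sum_subset_zero_on_sdiff (by intro k; simp; omega) (fun k hk => ?_)
      (fun k hk => ?_)
    · rw [if_neg (by simp at hk; omega)]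
      simp
    · have hk' : k ≤ N + r - p.deg - q.deg := Nat.lt_succ_iff.mp (Finset.mem_range.mp hk)
      rw [if_pos (by omega), show N - k + r - p.deg - q.deg = N + r - p.deg - q.deg - k by omega]
      push_cast
      ring
  · rw [Finset.sum_eq_zero]
    · simp
    · intro k hk
      rw [if_neg (by simp at hk; omega)]
      simp

/-- In degree m, the k = 0 term of `gramMatrix_add` is the old positive definite matrix, and the
others are semidefinite with nonnegative coefficients. -/
theorem IsAdmissible.add (hY : IsBlockSubdiagonal Y) {lam ε : ℝ} (hε : 0 < ε)
    (h : IsAdmissible lam Y) : IsAdmissible (lam + ε) Y := by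
  obtain ⟨hl, hM⟩ := h
  refine ⟨add_pos hl hε, (posDef_fullGram_iff hY (add_pos hl hε)).mpr ?_⟩
  rw [gramMatrix_add, Finset.sum_range_succ', binom_zero, Complex.ofReal_one, one_smul, Nat.sub_zero]
  refine PosDef.posSemidef_add (posSemidef_sum _ fun k _ => ?_)
    ((posDef_fullGram_iff hY hl).mp hM)
  exact (gramMatrix_posSemidef hY hl hM _).smul (by exact_mod_cast binom_nonneg hε _)

/-- A diagonal entry of I - λ⁻¹ Y_1 Y_1^* is 1 minus λ⁻¹ times the squared norm of a row of Y_1; its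
positivity bounds every entry of that row. -/
theorem IsAdmissible.normSq_lt {lam : ℝ} (h : IsAdmissible lam Y) {p q : BlockIndex d}
    (hp : p.deg = 1) (hq : q.deg = 0) : Complex.normSq (Y p q) < lam := by
  obtain ⟨hl, hM⟩ := h
  have h1 := hM.diag_pos (i := p)
  have h2 : fullGram lam Y p p = ((1 - lam⁻¹ * ∑ t : BlockIndex d,
      (if t.deg = 0 then Complex.normSq (Y p t) else 0) : ℝ) : ℂ) := by
    simp only [fullGram, of_apply, hp]
    rw [levelGram_eq]
    simp only [Finset.range_one, Finset.sum_singleton, levelGram_eq lam Y 0, Finset.range_zero,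
      Finset.sum_empty, sub_zero, Matrix.sub_apply, Matrix.smul_apply, smul_eq_mul]
    rw [mul_apply]
    simp only [levelProj, mul_diagonal, conjTranspose_apply, diagonal_apply_eq, hp]
    push_cast
    congr 2
    · simp [intertwiner, rising]
    · refine Finset.sum_congr rfl fun t _ => ?_
      split_ifs
      · rw [pow_one, mul_one, RCLike.star_def, Complex.mul_conj]
      · simp
  rw [h2] at h1
  have h3 : 0 < 1 - lam⁻¹ * ∑ t : BlockIndex d,
      (if t.deg = 0 then Complex.normSq (Y p t) else 0) := by exact_mod_cast h1
  have h4 : Complex.normSq (Y p q) ≤ ∑ t : BlockIndex d,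
      (if t.deg = 0 then Complex.normSq (Y p t) else 0) := by
    refine le_trans ?_ (Finset.single_le_sum (fun t _ => ?_) (Finset.mem_univ q))
    · rw [if_pos hq]
    · split_ifs
      · exact Complex.normSq_nonneg _
      · exact le_rfl
  have h5 : lam⁻¹ * ∑ t : BlockIndex d,
      (if t.deg = 0 then Complex.normSq (Y p t) else 0) < 1 := by linarith
  rw [inv_mul_lt_iff₀ hl, mul_one] at h5
  exact h4.trans_lt h5

end Threshold

end HomogeneousBundle

end

/-! ### The threshold as an infimum. -/

open HomogeneousBundle Filter Topology in
theorem mainTheorem4 (m : ℕ) (d : Fin (m + 1) → ℕ) (hd : ∀ j, 0 < d j)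
    (Y : Matrix (HomogeneousBundle.BlockIndex d) (HomogeneousBundle.BlockIndex d) ℂ)
    (hY : HomogeneousBundle.IsBlockSubdiagonal Y) :
    ∃ ηY : ℝ, 0 ≤ ηY ∧ (HomogeneousBundle.FirstBlockNonzero Y → 0 < ηY) ∧
      ∀ η : ℝ, (η, Y) ∈ HomogeneousBundle.reproducingPairs d ↔ ηY < η := by
  set S : Set ℝ := {η | IsAdmissible (2 * η) Y} with hS
  have hpos : ∀ η ∈ S, 0 < η := fun η hη => by
    have : 0 < 2 * η := hη.1
    linarith
  have hne : S.Nonempty := by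
    obtain ⟨x, hx⟩ := (eventually_isAdmissible hY).exists
    exact ⟨x / 2, by rw [hS]; simpa [mul_div_cancel₀] using hx⟩
  have hbdd : BddBelow S := ⟨0, fun η hη => (hpos η hη).le⟩
  refine ⟨sInf S, le_csInf hne fun η hη => (hpos η hη).le, ?_, fun η => ?_⟩
  · rintro ⟨p, q, hp, hq, hpq⟩
    have h1 : 0 < Complex.normSq (Y p q) := Complex.normSq_pos.mpr hpq
    -- The half comes from λ = 2η: admissibility gives |Y p q|² < 2η.
    refine (half_pos h1).trans_le (le_csInf hne fun η hη => ?_)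
    have h2 := IsAdmissible.normSq_lt (p := p) (q := q) hη hp hq
    linarith
  · have h1 : (η, Y) ∈ reproducingPairs d ↔ η ∈ S :=
      ⟨fun h => (hasReproducingKernel_iff hd hY η).mp h.2,
        fun h => ⟨hY, (hasReproducingKernel_iff hd hY η).mpr h⟩⟩
    rw [h1]
    constructor
    · intro hη
      -- Openness supplies an admissible point below η, so the infimum is not attained.
      have h2 : ∀ᶠ x in 𝓝 η, x ∈ S :=
        ((continuous_const_mul (2 : ℝ)).tendsto η).eventually (IsAdmissible.eventually hY hη)
      obtain ⟨x, hx, hxS⟩ := ((frequently_lt_nhds η).and_eventually h2).exists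
      exact (csInf_le hbdd hxS).trans_lt hx
    · intro hη
      obtain ⟨x, hxS, hx⟩ := exists_lt_of_csInf_lt hne hη
      have h3 := IsAdmissible.add hY (ε := 2 * (η - x)) (by linarith) hxS
      rwa [show 2 * x + 2 * (η - x) = 2 * η by ring] at h3
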